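/- **Setting.** Let $M$ be a smooth manifold of dimension $n+1$ and let $\pi:M\to\mathbb R$ be a fibration (a surjective smooth submersion). Let $V\pi=\ker d\pi\subset TM$, let $V^*\pi$ be the dual bundle of $V\pi$, let $\mu:T^*M\to V^*\pi$ be the restriction of covectors to $V\pi$, and let $\pi_1^*:V^*\pi\to\mathbb R$ be the composition of the bundle projection $V^*\pi\to M$ with $\pi$. A chart $(t,q^i)$ of $M$ with $t=\pi$ (an adapted chart) induces coordinates $(t,q^i,p_t,p_i)$ on $T^*M$ and $(t,q^i,p_i)$ on $V^*\pi$. Let $h:V^*\pi\to T^*M$ be a Hamiltonian section, that is, a smooth section of $\mu$; locally $h(t,q^i,p_i)=(t,q^i,-H(t,q,p),p_i)$. A smooth local section $\tau:U\to V^*\pi$ of $\pi_1^*$ ($U\subset\mathbb R$ open) is a *solution of Hamilton's equations for $h$* if in adapted coordinates $$\frac{dq^i}{dt}=\frac{\partial H}{\partial p_i},\qquad \frac{dp_i}{dt}=-\frac{\partial H}{\partial q^i}\qquad(i=1,\dots,n).$$ *The bijection $b_\pi$.* Let $\mathbb R$ act on $T^*M$ by $\zeta\mapsto\zeta+r\,d\pi$,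 with generator $V_\mu=\partial/\partial p_t$. Let $\hat V_\mu^{-1}(1)\subset T^*(T^*M)$ be the set of covectors $\gamma$ with $\gamma(V_\mu)=1$, let $\mathcal P\mu=\hat V_\mu^{-1}(1)/\mathbb R$ be the quotient by the cotangent lift of the action, and let $\mathcal P\mu/\langle d\pi_1^*\rangle$ be the further quotient identifying $[\gamma]$ with $[\gamma+r\,\mu^*d\pi_1^*]$ for $r\in\mathbb R$. Identify the first jet bundle with $J^1\pi_1^*=\{v\in T(V^*\pi): d\pi_1^*(v)=1\}$, so that $j^1\tau(t)=\dot\tau(t)$. Let $\Omega=-d\theta=dt\wedge dp_t+dq^i\wedge dp_i$ be the canonical symplectic form of $T^*M$ ($\theta$ the Liouville form) and $b_\Omega(X)=\iota_X\Omega$. The map $T\mu\circ b_\Omega^{-1}:\hat V_\mu^{-1}(1)\to J^1\pi_1^*$ induces a bijection $\mathcal P\mu/\langle d\pi_1^*\rangle\to J^1\pi_1^*$, whose inverse is denoted by $b_\pi$. *The section $\widetilde{dh}$.* Let $F_h:T^*M\to\mathbb R$ be the function with $\zeta=h(\mu(\zeta))+F_h(\zeta)\,d\pi$ for all $\zeta$.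 Then $dF_h(V_\mu)=1$ and $dF_h$ is invariant under the action, so it induces a section $dh:V^*\pi\to\mathcal P\mu$, and hence a section $\widetilde{dh}:V^*\pi\to\mathcal P\mu/\langle d\pi_1^*\rangle$. *Poisson structures.* Let $\Lambda_{V^*\pi}$ be the Poisson structure on $V^*\pi$ for which $\mu$ is a Poisson map, locally $\frac{\partial}{\partial q^i}\wedge\frac{\partial}{\partial p_i}$. Its complete lift to $T(V^*\pi)$ is tangent to $J^1\pi_1^*$; let $\Lambda_{J^1\pi_1^*}$ be its restriction to $J^1\pi_1^*$. A submanifold $C$ of a Poisson manifold $(P,\Lambda)$ is *Lagrangian* if at each $x\in C$ one has $\Lambda(\alpha,\beta)=0$ for all $\alpha,\beta\in(\Lambda^\sharp_x)^{-1}(T_xC)$ and $\dim\big(T_xC\cap\Lambda_x^\sharp(T_x^*P)\big)=\tfrac12\dim\Lambda_x^\sharp(T^*_xP)$. **Theorem.** 1. A smooth local section $\tau:U\to V^*\pi$ of $\pi_1^*$ is a solution of Hamilton's equations for $h$ if and only if $$b_\pi^{-1}\circ\widetilde{dh}\circ\tau=j^1\tau\quad\text{on } U.$$ 2. The set $S_h=b_\pi^{-1}\big(\widetilde{dh}(V^*\pi)\big)\subset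 J^1\pi_1^*$ is a Lagrangian submanifold of the Poisson manifold $(J^1\pi_1^*,\Lambda_{J^1\pi_1^*})$, and its local equations are Hamilton's equations for $h$: for each adapted chart, in the induced coordinates $(t,q^i,p_i,\dot q^i,\dot p_i)$ on $J^1\pi_1^*$, the submanifold $S_h$ is, on the whole domain of the coordinates, the common zero set of the smooth functions $$\dot q^i-\frac{\partial H}{\partial p_i}(t,q,p),\qquad \dot p_i+\frac{\partial H}{\partial q^i}(t,q,p)\qquad(i=1,\dots,n),$$ and the differentials of these $2n$ functions are linearly independent at each point. -/

import Mathlib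

open scoped Manifold ContDiff Topology
open Set

noncomputable section

set_option linter.unusedSectionVars false

namespace TimeDep

/-- `ℝ × ℝⁿ`, with coordinates `(t, qⁱ)`. -/
abbrev Base (n : ℕ) : Type := ℝ × (Fin n → ℝ)

section Fibration

variable (n : ℕ) {M : Type*} [TopologicalSpace M] [ChartedSpace (Base n) M]

/-- `π : M → ℝ` is a fibration: a surjective smooth submersion. -/
class IsFibration (π : M → ℝ) : Prop where
  surjective : Function.Surjective π
  submersion : ∀ x, Manifold.IsSubmersionAt 𝓘(ℝ, Base n) 𝓘(ℝ, ℝ) ∞ π x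

/-- A smooth chart `(t, qⁱ)` of `M` adapted to `π`, that is, with `t = π`. -/
structure AdaptedChart (π : M → ℝ) where
  e : OpenPartialHomeomorph M (Base n)
  mem : e ∈ IsManifold.maximalAtlas 𝓘(ℝ, Base n) ∞ M
  fst_eq : ∀ x ∈ e.source, (e x).1 = π x

variable {n} in
theorem IsFibration.exists_adaptedChart [IsManifold 𝓘(ℝ, Base n) ∞ M] (π : M → ℝ)
    [h : IsFibration n π] (x : M) : ∃ c : AdaptedChart n π, x ∈ c.e.source := by
  obtain ⟨F, _, _, ⟨φ, ψ, hx, hπx, hφ, hψ, hsub, L, hL⟩⟩ := h.submersion x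
  have hdim : Module.finrank ℝ F = n := by
    have : FiniteDimensional ℝ (ℝ × F) := L.toLinearEquiv.finiteDimensional
    have : FiniteDimensional ℝ F :=
      FiniteDimensional.of_surjective (LinearMap.snd ℝ ℝ F) LinearMap.snd_surjective
    have h1 := L.toLinearEquiv.finrank_eq
    simp only [Module.finrank_prod, Module.finrank_self, Module.finrank_fin_fun] at h1
    omega
  have : FiniteDimensional ℝ (ℝ × F) := L.toLinearEquiv.finiteDimensional
  have : FiniteDimensional ℝ F :=
      FiniteDimensional.of_surjective (LinearMap.snd ℝ ℝ F) LinearMap.snd_surjective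
  let κ : F ≃L[ℝ] (Fin n → ℝ) := ContinuousLinearEquiv.ofFinrankEq (by simp [hdim])
  let g : OpenPartialHomeomorph (Base n) (Base n) :=
    L.toHomeomorph.toOpenPartialHomeomorph.trans
      (ψ.symm.prod κ.toHomeomorph.toOpenPartialHomeomorph)
  have hψs : ContDiffOn ℝ ∞ ψ ψ.source :=
    contMDiffOn_iff_contDiffOn.1 (contMDiffOn_of_mem_maximalAtlas hψ)
  have hψt : ContDiffOn ℝ ∞ ψ.symm ψ.target :=
    contMDiffOn_iff_contDiffOn.1 (contMDiffOn_symm_of_mem_maximalAtlas hψ)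
  have hg : ContMDiffOn 𝓘(ℝ, Base n) 𝓘(ℝ, Base n) ∞ g g.source := by
    rw [contMDiffOn_iff_contDiffOn]
    have : ContDiffOn ℝ ∞ (fun y : Base n => (ψ.symm (L y).1, κ (L y).2)) g.source := by
      refine ContDiffOn.prodMk (hψt.comp (by fun_prop) ?_) (by fun_prop)
      intro y hy
      simpa [g] using hy
    exact this
  have hg' : ContMDiffOn 𝓘(ℝ, Base n) 𝓘(ℝ, Base n) ∞ g.symm g.target := by
    rw [contMDiffOn_iff_contDiffOn]
    have : ContDiffOn ℝ ∞ (fun y : Base n => L.symm (ψ y.1, κ.symm y.2)) g.target := by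
      refine L.symm.contDiff.comp_contDiffOn
        (ContDiffOn.prodMk (hψs.comp (by fun_prop) ?_) (by fun_prop))
      intro y hy
      simpa [g] using hy
    exact this
  have hval : ∀ y ∈ φ.source, ψ (π y) = (L (φ y)).1 := by
    intro y hy
    have := hL (x := φ y) (by simpa using φ.map_source hy)
    simpa [φ.left_inv hy] using this
  refine ⟨⟨φ.trans g, ?_, ?_⟩, ?_⟩
  · apply OpenPartialHomeomorph.mem_maximalAtlas_of_contMDiffOn
    · exact hg.comp ((contMDiffOn_of_mem_maximalAtlas hφ).mono (by simp)) (by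
        intro y hy; simpa using hy.2)
    · exact (contMDiffOn_symm_of_mem_maximalAtlas hφ).comp (hg'.mono (by
        intro y hy; simpa using hy.1)) (by intro y hy; simpa using hy.2)
  · intro y hy
    have hy1 : y ∈ φ.source := hy.1
    have : ((φ.trans g) y).1 = ψ.symm (L (φ y)).1 := rfl
    rw [this, ← hval y hy1, ψ.left_inv (hsub hy1)]
  · have : (L (φ x)).1 ∈ ψ.target := by
      rw [← hval x hx]; exact ψ.map_source hπx
    simp [g, hx, this]

end Fibration

section Core

variable {X ι E : Type*} [NormedAddCommGroup E] [NormedSpace ℝ E]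

/-- The charted space structure on a set `X` defined by a covering family of charts with
smooth transition maps. -/
abbrev smoothCore (ch : ι → PartialEquiv X E) (pick : X → ι)
    (hpick : ∀ x, x ∈ (ch (pick x)).source)
    (hopen : ∀ i j, IsOpen ((ch i).symm.trans (ch j)).source)
    (hsmooth : ∀ i j, ContDiffOn ℝ ∞ ((ch i).symm.trans (ch j)) ((ch i).symm.trans (ch j)).source) :
    ChartedSpaceCore E X where
  atlas := range ch
  chartAt x := ch (pick x)
  mem_chart_source := hpick
  chart_mem_atlas x := ⟨pick x, rfl⟩
  open_source := by rintro _ _ ⟨i, rfl⟩ ⟨j, rfl⟩; exact hopen i j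
  continuousOn_toFun := by rintro _ _ ⟨i, rfl⟩ ⟨j, rfl⟩; exact (hsmooth i j).continuousOn

theorem smoothCore_isManifold (ch : ι → PartialEquiv X E) (pick : X → ι)
    (hpick : ∀ x, x ∈ (ch (pick x)).source)
    (hopen : ∀ i j, IsOpen ((ch i).symm.trans (ch j)).source)
    (hsmooth : ∀ i j, ContDiffOn ℝ ∞ ((ch i).symm.trans (ch j)) ((ch i).symm.trans (ch j)).source) :
    letI c := smoothCore ch pick hpick hopen hsmooth
    letI := c.toTopologicalSpace
    letI := c.toChartedSpace
    IsManifold 𝓘(ℝ, E) ∞ X := by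
  let c := smoothCore ch pick hpick hopen hsmooth
  let _ := c.toTopologicalSpace
  let _ := c.toChartedSpace
  refine isManifold_of_contDiffOn _ _ _ ?_
  intro e e' he he'
  simp only [atlas, ChartedSpace.atlas, mem_iUnion, mem_singleton_iff] at he he'
  obtain ⟨_, ⟨i, rfl⟩, rfl⟩ := he
  obtain ⟨_, ⟨j, rfl⟩, rfl⟩ := he'
  simpa using! hsmooth i j

end Core

section Bundles

variable (n : ℕ) {M : Type*} [TopologicalSpace M] [ChartedSpace (Base n) M] (π : M → ℝ)

/-- The 1-form `η = dπ = π*(dt)` on `M`. -/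
def dpi (x : M) : TangentSpace 𝓘(ℝ, Base n) x →L[ℝ] ℝ := mfderiv 𝓘(ℝ, Base n) 𝓘(ℝ, ℝ) π x

/-- The vertical space `V_xπ = ker d_xπ`. -/
abbrev Vert (x : M) : Submodule ℝ (TangentSpace 𝓘(ℝ, Base n) x) := (dpi n π x).ker

/-- The dual bundle `V*π` of the vertical bundle of `π`. Its smooth structure is given below by the
charts `(t, qⁱ, p_i)` induced by adapted charts. -/
structure VDual where
  base : M
  form : Vert n π base →L[ℝ] ℝ

/-- The cotangent bundle `T*M`. Its smooth structure is the usual one, given by the canonical charts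
`(t, qⁱ, p_t, p_i)`; the parameter `_π` only serves to use the charts induced by adapted charts of
`M` as atlas, which is a covering family of canonical charts. -/
structure Cotan {M : Type*} [TopologicalSpace M] [ChartedSpace (Base n) M] (_π : M → ℝ) where
  base : M
  form : TangentSpace 𝓘(ℝ, Base n) base →L[ℝ] ℝ

variable {n π}

/-- The linear form `p_t dt + p_i dqⁱ` on `ℝ × ℝⁿ`. -/
def ofCoeffs (a : Base n) : Base n →L[ℝ] ℝ :=
  a.1 • ContinuousLinearMap.fst ℝ ℝ (Fin n → ℝ) +
    ∑ i, a.2 i • (ContinuousLinearMap.proj i).comp (ContinuousLinearMap.snd ℝ ℝ (Fin n → ℝ))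

theorem ofCoeffs_apply (a v : Base n) : ofCoeffs a v = a.1 * v.1 + ∑ i, a.2 i * v.2 i := by
  simp [ofCoeffs]

/-- The coefficients of a linear form. -/
def coeffs (l : Base n →L[ℝ] ℝ) : Base n := (l (1, 0), fun i => l (0, Pi.single i 1))

theorem coeffs_ofCoeffs (a : Base n) : coeffs (ofCoeffs a) = a := by
  ext i
  · simp [coeffs, ofCoeffs_apply]
  · simp [coeffs, ofCoeffs_apply, Pi.single_apply]

theorem ofCoeffs_coeffs (l : Base n →L[ℝ] ℝ) : ofCoeffs (coeffs l) = l := by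
  ext v
  · simp [coeffs, ofCoeffs_apply]
  · have h := ((l.comp (ContinuousLinearMap.inr ℝ ℝ (Fin n → ℝ))) : _ →ₗ[ℝ] ℝ).pi_apply_eq_sum_univ v
    have h2 : ∀ i : Fin n, (fun j => if i = j then (1 : ℝ) else 0) = Pi.single i 1 := by
      intro i; ext j; simp [Pi.single_apply, eq_comm]
    simpa [coeffs, ofCoeffs_apply, h2, mul_comm] using h.symm

theorem contDiff_ofCoeffs : ContDiff ℝ ∞ (ofCoeffs (n := n)) := by
  unfold ofCoeffs; fun_prop

namespace AdaptedChart

variable (c : AdaptedChart n π)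

theorem mdifferentiable : c.e.MDifferentiable 𝓘(ℝ, Base n) 𝓘(ℝ, Base n) :=
  ⟨fun _ hx => ((contMDiffOn_of_mem_maximalAtlas c.mem).mdifferentiableOn (by simp)) _ hx,
   fun _ hx => ((contMDiffOn_symm_of_mem_maximalAtlas c.mem).mdifferentiableOn (by simp)) _ hx⟩

/-- The differential `d_x e : T_xM → ℝ × ℝⁿ` of an adapted chart. -/
def diff (x : M) : TangentSpace 𝓘(ℝ, Base n) x →L[ℝ] Base n :=
  mfderiv 𝓘(ℝ, Base n) 𝓘(ℝ, Base n) c.e x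

/-- The coordinate frame `(τ, v) ↦ τ ∂/∂t + vⁱ ∂/∂qⁱ`, the inverse of the differential of the chart
at the points of its domain. -/
def frame (x : M) : Base n →L[ℝ] TangentSpace 𝓘(ℝ, Base n) x :=
  mfderiv 𝓘(ℝ, Base n) 𝓘(ℝ, Base n) c.e.symm (c.e x)

variable {c} {x : M}

theorem frame_diff (hx : x ∈ c.e.source) (u : TangentSpace 𝓘(ℝ, Base n) x) :
    c.frame x (c.diff x u) = u :=
  DFunLike.congr_fun (c.mdifferentiable.symm_comp_deriv hx) u

theorem diff_frame (hx : x ∈ c.e.source) (v : Base n) : c.diff x (c.frame x v) = v := by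
  have h := DFunLike.congr_fun (c.mdifferentiable.comp_symm_deriv (c.e.map_source hx)) v
  have h2 := c.e.left_inv hx
  have h3 : c.diff (c.e.symm (c.e x)) (c.frame x v) = v := h
  rwa [h2] at h3

theorem dpi_eq (hx : x ∈ c.e.source) (u : TangentSpace 𝓘(ℝ, Base n) x) :
    dpi n π x u = (c.diff x u).1 := by
  have h : π =ᶠ[𝓝 x] fun y => (c.e y).1 := by
    filter_upwards [c.e.open_source.mem_nhds hx] with y hy using (c.fst_eq y hy).symm
  have h1 : HasMFDerivAt 𝓘(ℝ, Base n) 𝓘(ℝ, ℝ) (fun y => (c.e y).1) x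
      ((ContinuousLinearMap.fst ℝ ℝ (Fin n → ℝ)).comp (c.diff x)) :=
    HasMFDerivAt.comp x (ContinuousLinearMap.fst ℝ ℝ (Fin n → ℝ)).hasMFDerivAt
      (c.mdifferentiable.mdifferentiableAt hx).hasMFDerivAt
  unfold dpi
  rw [h.mfderiv_eq, h1.mfderiv]
  rfl

theorem frame_mem (hx : x ∈ c.e.source) (v : Fin n → ℝ) : c.frame x (0, v) ∈ Vert n π x := by
  rw [LinearMap.mem_ker]
  exact (dpi_eq hx _).trans (by rw [diff_frame hx])


variable (c)

/-- The canonical chart `(t, qⁱ, p_t, p_i)` of `T*M` induced by an adapted chart. -/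
def cotanChart : PartialEquiv (Cotan n π) (Base n × Base n) where
  toFun ζ := (c.e ζ.base, coeffs (ζ.form.comp (c.frame ζ.base)))
  invFun z := ⟨c.e.symm z.1, (ofCoeffs z.2).comp (c.diff (c.e.symm z.1))⟩
  source := {ζ | ζ.base ∈ c.e.source}
  target := c.e.target ×ˢ univ
  map_source' ζ hζ := ⟨c.e.map_source hζ, mem_univ _⟩
  map_target' z hz := c.e.map_target hz.1
  left_inv' := by
    rintro ⟨x, l⟩ (hx : x ∈ c.e.source)
    have key : ∀ y, y = x → (⟨y, (ofCoeffs (coeffs (l.comp (c.frame x)))).comp (c.diff y)⟩ :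
        Cotan n π) = ⟨x, l⟩ := by
      rintro _ rfl
      rw [ofCoeffs_coeffs]
      congr 1
      ext u
      exact congrArg l (frame_diff hx u)
    exact key _ (c.e.left_inv hx)
  right_inv' := by
    rintro ⟨y, a⟩ ⟨hy, -⟩
    have h : ((ofCoeffs a).comp (c.diff (c.e.symm y))).comp (c.frame (c.e.symm y)) = ofCoeffs a := by
      refine ContinuousLinearMap.ext fun v => ?_
      exact congrArg (ofCoeffs a) (diff_frame (c.e.map_target hy) v)
    exact Prod.ext (c.e.right_inv hy) ((congrArg coeffs h).trans (coeffs_ofCoeffs a))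

open Classical in
/-- The chart `(t, qⁱ, p_i)` of `V*π` induced by an adapted chart: `p_i` is the value of the form
on the vertical vector `∂/∂qⁱ`. -/
def vdualChart : PartialEquiv (VDual n π) (Base n × (Fin n → ℝ)) where
  toFun ξ := (c.e ξ.base, fun i =>
    if h : ξ.base ∈ c.e.source then ξ.form ⟨c.frame ξ.base (0, Pi.single i 1), frame_mem h _⟩ else 0)
  invFun z := ⟨c.e.symm z.1,
    ((ofCoeffs (0, z.2)).comp (c.diff (c.e.symm z.1))).comp (Vert n π (c.e.symm z.1)).subtypeL⟩
  source := {ξ | ξ.base ∈ c.e.source}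
  target := c.e.target ×ˢ univ
  map_source' ζ hζ := ⟨c.e.map_source hζ, mem_univ _⟩
  map_target' z hz := c.e.map_target hz.1
  left_inv' := by
    rintro ⟨x, l⟩ (hx : x ∈ c.e.source)
    have key : ∀ y, y = x → (⟨y, ((ofCoeffs (0, fun i =>
        if h : x ∈ c.e.source then l ⟨c.frame x (0, Pi.single i 1), frame_mem h _⟩ else 0)).comp
          (c.diff y)).comp (Vert n π y).subtypeL⟩ : VDual n π) = ⟨x, l⟩ := by
      intro y hyx
      subst hyx
      congr 1
      ext ⟨u, hu⟩
      have hu1 : (c.diff y u).1 = 0 := (dpi_eq hx u).symm.trans hu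
      let L : (Fin n → ℝ) →ₗ[ℝ] Vert n π y :=
        { toFun := fun v => ⟨c.frame y (0, v), frame_mem hx v⟩
          map_add' := fun v w => Subtype.ext (by
            simpa using (c.frame y).map_add (0, v) (0, w))
          map_smul' := fun r v => Subtype.ext (by
            simpa using (c.frame y).map_smul r (0, v)) }
      have h1 : (⟨u, hu⟩ : Vert n π y) = L (c.diff y u).2 := by
        apply Subtype.ext
        have : ((0 : ℝ), (c.diff y u).2) = c.diff y u := Prod.ext hu1.symm rfl
        exact (frame_diff hx u).symm.trans (congrArg (c.frame y) this.symm)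
      have h2 := ((l : Vert n π y →ₗ[ℝ] ℝ).comp L).pi_apply_eq_sum_univ (c.diff y u).2
      have h3 : l ⟨u, hu⟩ = ((l : Vert n π y →ₗ[ℝ] ℝ).comp L) (c.diff y u).2 := by rw [h1]; rfl
      rw [h3, h2]
      refine (ofCoeffs_apply _ _).trans ?_
      simp only [hx, dif_pos, zero_mul, zero_add, smul_eq_mul]
      refine Finset.sum_congr rfl fun i _ => ?_
      rw [mul_comm]
      congr 1
      change l _ = l (L _)
      congr 1
      apply Subtype.ext
      change c.frame y _ = c.frame y _
      congr 2
      ext j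
      simp [Pi.single_apply, eq_comm]
    exact key _ (c.e.left_inv hx)
  right_inv' := by
    rintro ⟨y, p⟩ ⟨hy, -⟩
    refine Prod.ext (c.e.right_inv hy) ?_
    funext i
    have hx := c.e.map_target hy
    simp only [hx, dif_pos]
    have h := diff_frame hx (0, Pi.single i 1)
    refine (congrArg (ofCoeffs (0, p)) h).trans ?_
    simp [ofCoeffs_apply, Pi.single_apply]

variable (c' : AdaptedChart n π)

/-- The differential of a change of adapted charts, as a function of the first chart. -/
def transDiff (y : Base n) : Base n →L[ℝ] Base n :=
  fderiv ℝ (c.e ∘ c'.e.symm) (c'.e (c.e.symm y))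

theorem transDiff_eq {x : M} (hx : x ∈ c.e.source) (hx' : x ∈ c'.e.source) (v : Base n) :
    c.transDiff c' (c.e x) v = c.diff x (c'.frame x v) := by
  have h1 : MDifferentiableAt 𝓘(ℝ, Base n) 𝓘(ℝ, Base n) c.e (c'.e.symm (c'.e x)) := by
    rw [c'.e.left_inv hx']; exact c.mdifferentiable.mdifferentiableAt hx
  have h2 := mfderiv_comp_apply (I := 𝓘(ℝ, Base n)) (I' := 𝓘(ℝ, Base n)) (I'' := 𝓘(ℝ, Base n)) (c'.e x)
    h1 (c'.mdifferentiable.mdifferentiableAt_symm (c'.e.map_source hx')) v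
  unfold transDiff
  rw [c.e.left_inv hx]
  rw [mfderiv_eq_fderiv] at h2
  refine h2.trans ?_
  change c.diff (c'.e.symm (c'.e x)) (c'.frame x v) = _
  rw [c'.e.left_inv hx']

theorem contDiffOn_trans : ContDiffOn ℝ ∞ (c'.e ∘ c.e.symm) (c.e.symm.trans c'.e).source := by
  rw [← contMDiffOn_iff_contDiffOn]
  exact (contMDiffOn_of_mem_maximalAtlas c'.mem).comp
    ((contMDiffOn_symm_of_mem_maximalAtlas c.mem).mono (by intro y hy; exact hy.1))
    (by intro y hy; exact hy.2)

theorem contDiffOn_transDiff :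
    ContDiffOn ℝ ∞ (c.transDiff c') (c.e.symm.trans c'.e).source := by
  have h := (c'.contDiffOn_trans c).fderiv_of_isOpen (m := ∞) (c'.e.symm.trans c.e).open_source
    (by simp)
  refine h.comp (c.contDiffOn_trans c') ?_
  intro y hy
  have h1 : y ∈ c.e.target := hy.1
  have h2 : c.e.symm y ∈ c'.e.source := hy.2
  refine ⟨c'.e.map_source h2, ?_⟩
  change c'.e.symm (c'.e (c.e.symm y)) ∈ c.e.source
  rw [c'.e.left_inv h2]
  exact c.e.map_target h1

theorem contDiff_coeffs : ContDiff ℝ ∞ (coeffs (n := n)) := by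
  unfold coeffs
  refine ContDiff.prodMk (by fun_prop) (contDiff_pi.2 fun i => by fun_prop)

theorem cotanChart_isOpen : IsOpen (c.cotanChart.symm.trans c'.cotanChart).source := by
  convert (c.e.symm.trans c'.e).open_source.prod (isOpen_univ (X := Base n)) using 1
  ext ⟨y, a⟩
  exact ⟨fun h => ⟨⟨h.1.1, h.2⟩, mem_univ _⟩, fun h => ⟨⟨h.1.1, mem_univ _⟩, h.1.2⟩⟩

theorem vdualChart_isOpen : IsOpen (c.vdualChart.symm.trans c'.vdualChart).source := by
  convert (c.e.symm.trans c'.e).open_source.prod (isOpen_univ (X := Fin n → ℝ)) using 1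
  ext ⟨y, a⟩
  exact ⟨fun h => ⟨⟨h.1.1, h.2⟩, mem_univ _⟩, fun h => ⟨⟨h.1.1, mem_univ _⟩, h.1.2⟩⟩

theorem cotanChart_contDiffOn : ContDiffOn ℝ ∞ (c.cotanChart.symm.trans c'.cotanChart)
    (c.cotanChart.symm.trans c'.cotanChart).source := by
  have h : ContDiffOn ℝ ∞ (fun z : Base n × Base n => ((c'.e ∘ c.e.symm) z.1,
      coeffs ((ofCoeffs z.2).comp (c.transDiff c' z.1))))
      (c.cotanChart.symm.trans c'.cotanChart).source := by
    have hm : MapsTo Prod.fst (c.cotanChart.symm.trans c'.cotanChart).source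
        (c.e.symm.trans c'.e).source := by
      intro z hz
      exact ⟨hz.1.1, hz.2⟩
    refine ((c.contDiffOn_trans c').comp contDiff_fst.contDiffOn hm).prodMk
      (contDiff_coeffs.comp_contDiffOn (ContDiffOn.clm_comp ?_ ?_))
    · exact (contDiff_ofCoeffs.comp contDiff_snd).contDiffOn
    · exact (c.contDiffOn_transDiff c').comp contDiff_fst.contDiffOn hm
  refine h.congr ?_
  rintro ⟨y, a⟩ hz
  have h1 : y ∈ c.e.target := hz.1.1
  have h2 : c.e.symm y ∈ c'.e.source := hz.2
  refine Prod.ext rfl (congrArg coeffs ?_)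
  refine ContinuousLinearMap.ext fun v => ?_
  refine congrArg (ofCoeffs a) ?_
  have := c.transDiff_eq c' (c.e.map_target h1) h2 v
  rw [c.e.right_inv h1] at this
  exact this.symm

theorem vdualChart_contDiffOn : ContDiffOn ℝ ∞ (c.vdualChart.symm.trans c'.vdualChart)
    (c.vdualChart.symm.trans c'.vdualChart).source := by
  have h : ContDiffOn ℝ ∞ (fun z : Base n × (Fin n → ℝ) => ((c'.e ∘ c.e.symm) z.1,
      (coeffs ((ofCoeffs (0, z.2)).comp (c.transDiff c' z.1))).2))
      (c.vdualChart.symm.trans c'.vdualChart).source := by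
    have hm : MapsTo Prod.fst (c.vdualChart.symm.trans c'.vdualChart).source
        (c.e.symm.trans c'.e).source := by
      intro z hz
      exact ⟨hz.1.1, hz.2⟩
    refine ((c.contDiffOn_trans c').comp contDiff_fst.contDiffOn hm).prodMk
      ((contDiff_snd.comp contDiff_coeffs).comp_contDiffOn (ContDiffOn.clm_comp ?_ ?_))
    · exact (contDiff_ofCoeffs.comp (contDiff_const.prodMk contDiff_snd)).contDiffOn
    · exact (c.contDiffOn_transDiff c').comp contDiff_fst.contDiffOn hm
  refine h.congr ?_
  rintro ⟨y, p⟩ hz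
  have h1 : y ∈ c.e.target := hz.1.1
  have h2 : c.e.symm y ∈ c'.e.source := hz.2
  refine Prod.ext rfl ?_
  funext i
  have h3 := c.transDiff_eq c' (c.e.map_target h1) h2 (0, Pi.single i 1)
  rw [c.e.right_inv h1] at h3
  refine (dif_pos h2).trans ?_
  exact congrArg (ofCoeffs (0, p)) h3.symm

end AdaptedChart

variable [IsManifold 𝓘(ℝ, Base n) ∞ M] [IsFibration n π]

variable (π) in
/-- An adapted chart around a given point. -/
def chartAround (x : M) : AdaptedChart n π := (IsFibration.exists_adaptedChart π x).choose

theorem mem_chartAround (x : M) : x ∈ (chartAround π x : AdaptedChart n π).e.source :=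
  (IsFibration.exists_adaptedChart π x).choose_spec

variable (n π) in
/-- The atlas of `T*M`. -/
abbrev cotanCore : ChartedSpaceCore (Base n × Base n) (Cotan n π) :=
  smoothCore AdaptedChart.cotanChart (fun ζ => chartAround π ζ.base)
    (fun ζ => mem_chartAround ζ.base) AdaptedChart.cotanChart_isOpen
    AdaptedChart.cotanChart_contDiffOn

variable (n π) in
/-- The atlas of `V*π`. -/
abbrev vdualCore : ChartedSpaceCore (Base n × (Fin n → ℝ)) (VDual n π) :=
  smoothCore AdaptedChart.vdualChart (fun ξ => chartAround π ξ.base)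
    (fun ξ => mem_chartAround ξ.base) AdaptedChart.vdualChart_isOpen
    AdaptedChart.vdualChart_contDiffOn

instance : TopologicalSpace (Cotan n π) := (cotanCore n π).toTopologicalSpace
instance : ChartedSpace (Base n × Base n) (Cotan n π) := (cotanCore n π).toChartedSpace
instance : IsManifold 𝓘(ℝ, Base n × Base n) ∞ (Cotan n π) := smoothCore_isManifold _ _ _ _ _
instance : TopologicalSpace (VDual n π) := (vdualCore n π).toTopologicalSpace
instance : ChartedSpace (Base n × (Fin n → ℝ)) (VDual n π) := (vdualCore n π).toChartedSpace
instance : IsManifold 𝓘(ℝ, Base n × (Fin n → ℝ)) ∞ (VDual n π) := smoothCore_isManifold _ _ _ _ _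

end Bundles

section General

variable {E E' : Type*} [NormedAddCommGroup E] [NormedSpace ℝ E] [NormedAddCommGroup E']
  [NormedSpace ℝ E'] {N N' : Type*} [TopologicalSpace N] [ChartedSpace E N] [TopologicalSpace N']
  [ChartedSpace E' N']

theorem hasMFDerivAt_of_charts {f : N → N'} {x : N} {g : E → E'} {g' : E →L[ℝ] E'}
    (h1 : ∀ᶠ y in 𝓝 x, f y ∈ (chartAt E' (f x)).source)
    (h2 : ∀ᶠ y in 𝓝 x, chartAt E' (f x) (f y) = g (chartAt E x y))
    (hg : HasFDerivAt g g' (chartAt E x x)) :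
    HasMFDerivAt 𝓘(ℝ, E) 𝓘(ℝ, E') f x g' := by
  have hgx : g (chartAt E x x) = chartAt E' (f x) (f x) := h2.self_of_nhds.symm
  refine ⟨?_, ?_⟩
  · have hc : ContinuousAt (fun y => (chartAt E' (f x)).symm (g (chartAt E x y))) x := by
      refine ContinuousAt.comp (g := (chartAt E' (f x)).symm) ?_
        (hg.continuousAt.comp ((chartAt E x).continuousAt (mem_chart_source E x)))
      refine (chartAt E' (f x)).continuousAt_symm ?_
      rw [hgx]
      exact (chartAt E' (f x)).map_source (mem_chart_source E' (f x))
    refine hc.congr ?_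
    filter_upwards [h1, h2] with y hy1 hy2
    rw [← hy2, (chartAt E' (f x)).left_inv hy1]
  · have ht : Filter.Tendsto (chartAt E x).symm (𝓝 (chartAt E x x)) (𝓝 x) := by
      have := (chartAt E x).continuousAt_symm (mem_chart_target E x)
      rwa [ContinuousAt, (chartAt E x).left_inv (mem_chart_source E x)] at this
    have h3 : (fun z => chartAt E' (f x) (f ((chartAt E x).symm z))) =ᶠ[𝓝 (chartAt E x x)] g := by
      filter_upwards [ht.eventually h2, (chartAt E x).open_target.mem_nhds (mem_chart_target E x)]
        with z hz hz'
      rw [hz, (chartAt E x).right_inv hz']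
    have h4 := (hg.congr_of_eventuallyEq h3).hasFDerivWithinAt (s := range 𝓘(ℝ, E))
    exact h4

variable (E) in
/-- The exterior derivative of a 1-form, `dθ(X, Y) = X(θ(Y)) - Y(θ(X))` for the coordinate vector
fields `X`, `Y` of a chart. -/
def extDerivOne (θ : ∀ x : N, TangentSpace 𝓘(ℝ, E) x →L[ℝ] ℝ) (x : N) :
    TangentSpace 𝓘(ℝ, E) x →L[ℝ] TangentSpace 𝓘(ℝ, E) x →L[ℝ] ℝ :=
  let θ' : E → E →L[ℝ] ℝ := fun y =>
    (θ ((chartAt E x).symm y)).comp (mfderiv 𝓘(ℝ, E) 𝓘(ℝ, E) (chartAt E x).symm y)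
  let D : E →L[ℝ] E →L[ℝ] ℝ := fderiv ℝ θ' (chartAt E x x)
  D - D.flip

end General

section Phase

variable {n : ℕ} {M : Type*} [TopologicalSpace M] [ChartedSpace (Base n) M] {π : M → ℝ}
  [IsManifold 𝓘(ℝ, Base n) ∞ M] [IsFibration n π]

/-- The projection `π₁* : V*π → ℝ`. -/
def time (ξ : VDual n π) : ℝ := π ξ.base

/-- The projection `μ : T*M → V*π`, restriction of forms to vertical vectors. -/
def mu (ζ : Cotan n π) : VDual n π := ⟨ζ.base, ζ.form.comp (Vert n π ζ.base).subtypeL⟩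

/-- The differential of `π₁*`. -/
def dtime (ξ : VDual n π) : TangentSpace 𝓘(ℝ, Base n × (Fin n → ℝ)) ξ →L[ℝ] ℝ :=
  mfderiv 𝓘(ℝ, Base n × (Fin n → ℝ)) 𝓘(ℝ, ℝ) time ξ

/-- The tangent map of `μ`. -/
def dmu (ζ : Cotan n π) : TangentSpace 𝓘(ℝ, Base n × Base n) ζ →L[ℝ]
    TangentSpace 𝓘(ℝ, Base n × (Fin n → ℝ)) (mu ζ) :=
  mfderiv 𝓘(ℝ, Base n × Base n) 𝓘(ℝ, Base n × (Fin n → ℝ)) mu ζ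

/-- The action of `ℝ` on `T*M` for which `μ` is a principal bundle: `ζ ↦ ζ + r dπ`. -/
def translate (r : ℝ) (ζ : Cotan n π) : Cotan n π :=
  ⟨ζ.base, ζ.form + r • dpi n π ζ.base⟩

/-- The infinitesimal generator `V_μ` of the action of `ℝ` on `T*M`. -/
def genVec (ζ : Cotan n π) : TangentSpace 𝓘(ℝ, Base n × Base n) ζ :=
  mfderiv 𝓘(ℝ, ℝ) 𝓘(ℝ, Base n × Base n) (fun r : ℝ => translate r ζ) 0 (1 : ℝ)

/-- The Liouville 1-form of `T*M`. -/
def liouville (ζ : Cotan n π) : TangentSpace 𝓘(ℝ, Base n × Base n) ζ →L[ℝ] ℝ :=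
  ζ.form.comp (mfderiv 𝓘(ℝ, Base n × Base n) 𝓘(ℝ, Base n) Cotan.base ζ)

/-- The canonical symplectic form `Ω = -dθ` of `T*M`, as the map `X ↦ ι_X Ω`. -/
def symp (ζ : Cotan n π) : TangentSpace 𝓘(ℝ, Base n × Base n) ζ →L[ℝ]
    TangentSpace 𝓘(ℝ, Base n × Base n) ζ →L[ℝ] ℝ :=
  -extDerivOne (Base n × Base n) liouville ζ

variable (ζ : Cotan n π)

theorem chartAt_cotan : (chartAt (Base n × Base n) ζ : Cotan n π → Base n × Base n) =
    (chartAround π ζ.base).cotanChart := rfl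

theorem chartAt_cotan_symm : ((chartAt (Base n × Base n) ζ).symm : Base n × Base n → Cotan n π) =
    (chartAround π ζ.base).cotanChart.symm := rfl

theorem chartAt_vdual (ξ : VDual n π) : (chartAt (Base n × (Fin n → ℝ)) ξ :
    VDual n π → Base n × (Fin n → ℝ)) = (chartAround π ξ.base).vdualChart := rfl

theorem eventually_cotan (ζ : Cotan n π) :
    ∀ᶠ y in 𝓝 ζ, y.base ∈ (chartAround π ζ.base : AdaptedChart n π).e.source :=
  chart_source_mem_nhds (Base n × Base n) ζ

theorem vdualChart_mu (c : AdaptedChart n π) (hζ : ζ.base ∈ c.e.source) :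
    c.vdualChart (mu ζ) = ((c.cotanChart ζ).1, (c.cotanChart ζ).2.2) := by
  refine Prod.ext rfl ?_
  funext i
  exact dif_pos hζ

theorem cotanChart_translate (c : AdaptedChart n π) (hζ : ζ.base ∈ c.e.source) (r : ℝ) :
    c.cotanChart (translate r ζ) = c.cotanChart ζ + (0, (r, 0)) := by
  have h : ∀ v : Base n, (translate r ζ).form (c.frame ζ.base v) =
      ζ.form (c.frame ζ.base v) + r * v.1 := by
    intro v
    have h1 := AdaptedChart.dpi_eq hζ (c.frame ζ.base v)
    rw [AdaptedChart.diff_frame hζ] at h1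
    exact congrArg (fun s : ℝ => ζ.form (c.frame ζ.base v) + r * s) h1
  refine Prod.ext (by simp; rfl) (Prod.ext ?_ ?_)
  · exact (h _).trans (by simp; rfl)
  · funext i
    exact (h _).trans (by simp; rfl)

theorem hasMFDerivAt_mu : HasMFDerivAt 𝓘(ℝ, Base n × Base n) 𝓘(ℝ, Base n × (Fin n → ℝ)) mu ζ
    ((ContinuousLinearMap.fst ℝ (Base n) (Base n)).prod ((ContinuousLinearMap.snd ℝ ℝ (Fin n → ℝ)).comp
      (ContinuousLinearMap.snd ℝ (Base n) (Base n)))) := by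
  refine hasMFDerivAt_of_charts (eventually_cotan ζ) ?_ (ContinuousLinearMap.hasFDerivAt _)
  filter_upwards [eventually_cotan ζ] with y hy
  exact vdualChart_mu y _ hy

theorem hasMFDerivAt_translate (r : ℝ) : HasMFDerivAt 𝓘(ℝ, Base n × Base n)
    𝓘(ℝ, Base n × Base n) (translate r) ζ (ContinuousLinearMap.id ℝ (Base n × Base n)) := by
  refine hasMFDerivAt_of_charts (g := fun z => z + (0, (r, 0))) (eventually_cotan ζ) ?_
    ((hasFDerivAt_id _).add_const _)
  filter_upwards [eventually_cotan ζ] with y hy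
  exact cotanChart_translate y _ hy r

theorem hasMFDerivAt_line : HasMFDerivAt 𝓘(ℝ, ℝ) 𝓘(ℝ, Base n × Base n)
    (fun r : ℝ => translate r ζ) 0
    ((ContinuousLinearMap.inr ℝ (Base n) (Base n)).comp (ContinuousLinearMap.inl ℝ ℝ (Fin n → ℝ))) := by
  refine hasMFDerivAt_of_charts (g := fun r : ℝ => (chartAround π ζ.base).cotanChart ζ + (0, (r, 0)))
    (Filter.Eventually.of_forall fun r => mem_chartAround ζ.base) ?_ ?_
  · refine Filter.Eventually.of_forall fun r => ?_
    exact cotanChart_translate ζ _ (mem_chartAround ζ.base) r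
  · exact (ContinuousLinearMap.hasFDerivAt ((ContinuousLinearMap.inr ℝ (Base n) (Base n)).comp
      (ContinuousLinearMap.inl ℝ ℝ (Fin n → ℝ)))).const_add _

theorem genVec_eq : genVec ζ = ((0, (1, 0)) : Base n × Base n) := by
  unfold genVec
  rw [(hasMFDerivAt_line ζ).mfderiv]
  rfl

theorem hasMFDerivAt_time (ξ : VDual n π) : HasMFDerivAt 𝓘(ℝ, Base n × (Fin n → ℝ)) 𝓘(ℝ, ℝ) time ξ
    ((ContinuousLinearMap.fst ℝ ℝ (Fin n → ℝ)).comp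
      (ContinuousLinearMap.fst ℝ (Base n) (Fin n → ℝ))) := by
  refine hasMFDerivAt_of_charts (Filter.Eventually.of_forall fun _ => mem_univ _) ?_
    (ContinuousLinearMap.hasFDerivAt _)
  filter_upwards [chart_source_mem_nhds (Base n × (Fin n → ℝ)) ξ] with y hy
  exact ((chartAround π ξ.base : AdaptedChart n π).fst_eq _ hy).symm

/-- In canonical coordinates, the Liouville form is `p_t dt + p_i dqⁱ`. -/
theorem liouville_chart {z : Base n × Base n} (hz : z ∈ (chartAt (Base n × Base n) ζ).target) :
    (liouville ((chartAt (Base n × Base n) ζ).symm z)).comp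
      (mfderiv 𝓘(ℝ, Base n × Base n) 𝓘(ℝ, Base n × Base n) (chartAt (Base n × Base n) ζ).symm z) =
    (ofCoeffs z.2).comp (ContinuousLinearMap.fst ℝ (Base n) (Base n)) := by
  set φ := chartAt (Base n × Base n) ζ with hφ
  set c : AdaptedChart n π := chartAround π ζ.base with hc
  have hz1 : z.1 ∈ c.e.target := hz.1
  have hφd := mdifferentiable_chart (I := 𝓘(ℝ, Base n × Base n)) ζ
  have hsrc : φ.symm z ∈ φ.source := φ.map_target hz
  have hb : MDifferentiableAt 𝓘(ℝ, Base n × Base n) 𝓘(ℝ, Base n) Cotan.base (φ.symm z) := by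
    have h1 : MDifferentiableAt 𝓘(ℝ, Base n × Base n) 𝓘(ℝ, Base n)
        (fun y => c.e.symm (φ y).1) (φ.symm z) := by
      refine MDifferentiableAt.comp (I' := 𝓘(ℝ, Base n)) (φ.symm z)
        (c.mdifferentiable.mdifferentiableAt_symm ?_) ?_
      · have := φ.right_inv hz
        rw [this]; exact hz1
      · exact MDifferentiableAt.comp (I' := 𝓘(ℝ, Base n × Base n)) (φ.symm z)
          (ContinuousLinearMap.fst ℝ (Base n) (Base n)).mdifferentiableAt
          (hφd.mdifferentiableAt hsrc)
    refine h1.congr_of_eventuallyEq ?_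
    filter_upwards [φ.open_source.mem_nhds hsrc] with y hy
    exact (c.e.left_inv hy).symm
  have hcomp := mfderiv_comp (I' := 𝓘(ℝ, Base n × Base n)) z hb (hφd.mdifferentiableAt_symm hz)
  have hcomp2 := mfderiv_comp (I := 𝓘(ℝ, Base n × Base n)) (I' := 𝓘(ℝ, Base n)) (g := c.e.symm) z
    (c.mdifferentiable.mdifferentiableAt_symm hz1)
    (ContinuousLinearMap.fst ℝ (Base n) (Base n)).mdifferentiableAt
  have hfst : mfderiv 𝓘(ℝ, Base n × Base n) 𝓘(ℝ, Base n) (Prod.fst : Base n × Base n → Base n) z =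
      ContinuousLinearMap.fst ℝ (Base n) (Base n) := (ContinuousLinearMap.fst ℝ (Base n) (Base n)).hasMFDerivAt.mfderiv
  have heq : Cotan.base ∘ φ.symm = c.e.symm ∘ (ContinuousLinearMap.fst ℝ (Base n) (Base n)) := rfl
  rw [heq] at hcomp
  refine ContinuousLinearMap.ext fun X => ?_
  have h5 := DFunLike.congr_fun (hcomp.symm.trans hcomp2) X
  rw [hfst] at h5
  have h6 := DFunLike.congr_fun (c.mdifferentiable.comp_symm_deriv hz1) X.1
  exact (congrArg (φ.symm z).form h5).trans (congrArg (ofCoeffs z.2) h6)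

/-- In canonical coordinates, `Ω = dt ∧ dp_t + dqⁱ ∧ dp_i`. -/
theorem symp_eq (X Y : Base n × Base n) : symp ζ X Y = ofCoeffs Y.2 X.1 - ofCoeffs X.2 Y.1 := by
  let L : (Base n × Base n) →L[ℝ] (Base n × Base n →L[ℝ] ℝ) := LinearMap.toContinuousLinearMap
    { toFun := fun z => (ofCoeffs z.2).comp (ContinuousLinearMap.fst ℝ (Base n) (Base n))
      map_add' := fun z w => ContinuousLinearMap.ext fun v => by
        simp [ofCoeffs_apply, add_mul, Finset.sum_add_distrib]; ring
      map_smul' := fun z w => ContinuousLinearMap.ext fun v => by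
        simp [ofCoeffs_apply, mul_add, Finset.mul_sum, mul_assoc] }
  have h1 : (fun y => (liouville ((chartAt (Base n × Base n) ζ).symm y)).comp
      (mfderiv 𝓘(ℝ, Base n × Base n) 𝓘(ℝ, Base n × Base n) (chartAt (Base n × Base n) ζ).symm y))
      =ᶠ[𝓝 (chartAt (Base n × Base n) ζ ζ)] L := by
    filter_upwards [(chartAt (Base n × Base n) ζ).open_target.mem_nhds
      (mem_chart_target (Base n × Base n) ζ)] with y hy
    exact liouville_chart ζ hy
  have h2 : fderiv ℝ _ _ = L := (L.hasFDerivAt.congr_of_eventuallyEq h1).fderiv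
  have h3 : symp ζ = -(L - L.flip) := by
    unfold symp extDerivOne
    exact congrArg (fun D : (Base n × Base n) →L[ℝ] (Base n × Base n →L[ℝ] ℝ) => -(D - D.flip)) h2
  rw [h3]
  exact neg_sub (L X Y) (L Y X)

theorem symp_isInvertible : (symp ζ).IsInvertible := by
  let S : (Base n × Base n) →ₗ[ℝ] (Base n × Base n →L[ℝ] ℝ) :=
    (show (Base n × Base n) →L[ℝ] (Base n × Base n →L[ℝ] ℝ) from symp ζ).toLinearMap
  have hS : ∀ X Y : Base n × Base n, S X Y = ofCoeffs Y.2 X.1 - ofCoeffs X.2 Y.1 := symp_eq ζ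
  have hinj : Function.Injective S := by
    rw [← LinearMap.ker_eq_bot, LinearMap.ker_eq_bot']
    intro X hX
    have h : ∀ Y : Base n × Base n, ofCoeffs Y.2 X.1 - ofCoeffs X.2 Y.1 = 0 := by
      intro Y; rw [← hS, hX]; rfl
    refine Prod.ext (Prod.ext ?_ (funext fun i => ?_)) (Prod.ext ?_ (funext fun i => ?_))
    · simpa [ofCoeffs_apply] using h (0, (1, 0))
    · simpa [ofCoeffs_apply, Pi.single_apply] using h (0, (0, Pi.single i 1))
    · simpa [ofCoeffs_apply] using h ((1, 0), 0)
    · simpa [ofCoeffs_apply, Pi.single_apply] using h ((0, Pi.single i 1), 0)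
  have hsurj : Function.Surjective S := by
    intro A
    refine ⟨(coeffs (A.comp (ContinuousLinearMap.inr ℝ _ _)),
      -coeffs (A.comp (ContinuousLinearMap.inl ℝ _ _))), ContinuousLinearMap.ext fun Y => ?_⟩
    have h1 := DFunLike.congr_fun (ofCoeffs_coeffs (A.comp (ContinuousLinearMap.inl ℝ _ _))) Y.1
    have h2 := DFunLike.congr_fun (ofCoeffs_coeffs (A.comp (ContinuousLinearMap.inr ℝ _ _))) Y.2
    have h3 : A Y = A (Y.1, 0) + A (0, Y.2) := by rw [← map_add]; simp
    rw [hS, h3]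
    simp only [ContinuousLinearMap.comp_apply, ContinuousLinearMap.inl_apply,
      ContinuousLinearMap.inr_apply] at h1 h2
    rw [← h1, ← h2]
    simp only [ofCoeffs_apply, Prod.fst_neg, Prod.snd_neg, Pi.neg_apply, neg_mul,
      Finset.sum_neg_distrib]
    simp only [mul_comm Y.2.1, mul_comm (Y.2.2 _)]
    ring
  exact ⟨(LinearEquiv.ofBijective S ⟨hinj, hsurj⟩).toContinuousLinearEquiv, rfl⟩

/-- The inverse of `X ↦ ι_X Ω`. -/
def sympInv : (TangentSpace 𝓘(ℝ, Base n × Base n) ζ →L[ℝ] ℝ) →L[ℝ]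
    TangentSpace 𝓘(ℝ, Base n × Base n) ζ := (symp ζ).inverse

theorem symp_sympInv (A : TangentSpace 𝓘(ℝ, Base n × Base n) ζ →L[ℝ] ℝ) :
    symp ζ (sympInv ζ A) = A := by
  obtain ⟨e, he⟩ := symp_isInvertible ζ
  unfold sympInv
  rw [← he]
  simp

theorem sympInv_symp (X : TangentSpace 𝓘(ℝ, Base n × Base n) ζ) :
    sympInv ζ (symp ζ X) = X := by
  obtain ⟨e, he⟩ := symp_isInvertible ζ
  unfold sympInv
  rw [← he]
  simp


/-! ### The diffeomorphism `b_π` -/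

variable (n π) in
/-- The 1-jet bundle `J¹π₁*` of `π₁* : V*π → ℝ`, as the subset `{v | dπ₁*(v) = 1}` of `T(V*π)`. -/
def jetSet : Set (TangentBundle 𝓘(ℝ, Base n × (Fin n → ℝ)) (VDual n π)) :=
  {v | dtime v.proj v.2 = 1}

variable (n π) in
/-- The affine bundle `V̂_μ⁻¹(1)` of the 1-forms `γ` on `T*M` with `γ(V_μ) = 1`. -/
structure UnitForm where
  pt : Cotan n π
  form : TangentSpace 𝓘(ℝ, Base n × Base n) pt →L[ℝ] ℝ
  form_genVec : form (genVec pt) = 1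

/-- `B` is the image of `A` under the cotangent lift of the translation by some `r`. -/
def SameOrbit (A B : UnitForm n π) : Prop :=
  ∃ (r : ℝ) (γ : TangentSpace 𝓘(ℝ, Base n × Base n) (translate r A.pt) →L[ℝ] ℝ)
    (hγ : γ (genVec (translate r A.pt)) = 1),
    B = ⟨translate r A.pt, γ, hγ⟩ ∧ A.form = γ.comp
      (mfderiv 𝓘(ℝ, Base n × Base n) 𝓘(ℝ, Base n × Base n) (translate r) A.pt)

variable (n π) in
/-- The phase bundle `Pμ = V̂_μ⁻¹(1) / ℝ`. -/
def PhaseBundle : Type _ := Quot (SameOrbit (n := n) (π := π))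

/-- Two elements of `Pμ` which differ by a multiple of `dπ₁*`; here `T*(V*π)` acts on `Pμ` by
`β · [γ] = [γ + μ*β]`. -/
def SameModTime (P Q : PhaseBundle n π) : Prop :=
  ∃ (A : UnitForm n π) (r : ℝ) (h : (A.form + r • (dtime (mu A.pt)).comp (dmu A.pt)) (genVec A.pt) = 1),
    P = Quot.mk _ A ∧ Q = Quot.mk _ ⟨A.pt, A.form + r • (dtime (mu A.pt)).comp (dmu A.pt), h⟩

variable (n π) in
/-- The quotient affine bundle `Pμ / ⟨dπ₁*⟩`. -/
def ReducedPhase : Type _ := Quot (SameModTime (n := n) (π := π))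

theorem dtime_apply (ξ : VDual n π) (X : Base n × (Fin n → ℝ)) : dtime ξ X = X.1.1 := by
  unfold dtime; rw [(hasMFDerivAt_time ξ).mfderiv]; rfl

theorem dmu_apply (X : Base n × Base n) : dmu ζ X = ((X.1, X.2.2) : Base n × (Fin n → ℝ)) := by
  unfold dmu; rw [(hasMFDerivAt_mu ζ).mfderiv]; rfl

theorem symp_genVec_right (X : TangentSpace 𝓘(ℝ, Base n × Base n) ζ) :
    symp ζ X (genVec ζ) = dtime (mu ζ) (dmu ζ X) := by
  have h1 : symp ζ X (genVec ζ) = _ := congrArg (symp ζ X) (genVec_eq ζ)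
  have h2 : dtime (mu ζ) (dmu ζ X) = _ := congrArg (dtime (mu ζ)) (dmu_apply ζ X)
  rw [h1, h2]
  refine (symp_eq ζ X _).trans (Eq.trans ?_ (dtime_apply (mu ζ) _).symm)
  simp [ofCoeffs_apply]

theorem symp_genVec (X : TangentSpace 𝓘(ℝ, Base n × Base n) ζ) :
    symp ζ (genVec ζ) X = - dtime (mu ζ) (dmu ζ X) := by
  rw [← symp_genVec_right]
  have h1 : symp ζ X (genVec ζ) = _ := congrArg (symp ζ X) (genVec_eq ζ)
  have h2 : symp ζ (genVec ζ) X = _ := congrArg (fun Y => symp ζ Y X) (genVec_eq ζ)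
  rw [h1, h2]
  refine (symp_eq ζ _ X).trans (Eq.trans ?_ (congrArg Neg.neg (symp_eq ζ X _)).symm)
  simp

theorem dmu_genVec : dmu ζ (genVec ζ) = 0 :=
  (congrArg (dmu ζ) (genVec_eq ζ)).trans (dmu_apply ζ _)

theorem dmu_eq_zero {X : TangentSpace 𝓘(ℝ, Base n × Base n) ζ} (h : dmu ζ X = 0) :
    ∃ r : ℝ, X = r • genVec ζ := by
  have h1 : (((id X : Base n × Base n).1, (id X : Base n × Base n).2.2) : Base n × (Fin n → ℝ)) = 0 :=
    (dmu_apply ζ X).symm.trans h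
  refine ⟨(id X : Base n × Base n).2.1, ?_⟩
  rw [genVec_eq]
  have h2 := congrArg Prod.fst h1
  have h3 := congrArg Prod.snd h1
  refine Prod.ext (h2.trans ?_) (Prod.ext ?_ (h3.trans ?_))
  · exact (smul_zero (A := Base n) _).symm
  · exact (mul_one (id X : Base n × Base n).2.1).symm
  · exact (smul_zero (A := Fin n → ℝ) _).symm

theorem mk_eq_mk {ξ ξ' : VDual n π} (h : ξ = ξ') (X : Base n × (Fin n → ℝ)) :
    (⟨ξ, X⟩ : TangentBundle 𝓘(ℝ, Base n × (Fin n → ℝ)) (VDual n π)) = ⟨ξ', X⟩ := by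
  subst h; rfl

/-- The map `φ = Tμ ∘ b_Ω⁻¹ : V̂_μ⁻¹(1) → J¹π₁*`. -/
def phi (A : UnitForm n π) : jetSet n π :=
  ⟨⟨mu A.pt, dmu A.pt (sympInv A.pt A.form)⟩, by
    refine (symp_genVec_right _ _).symm.trans ?_
    rw [symp_sympInv, A.form_genVec]⟩

theorem mu_translate (r : ℝ) : mu (translate r ζ) = mu ζ := by
  unfold mu translate
  congr 1
  ext ⟨u, hu⟩
  have : dpi n π ζ.base u = 0 := hu
  change ζ.form u + r * dpi n π ζ.base u = ζ.form u
  rw [this]; ring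

theorem exists_translate {ζ ζ' : Cotan n π} (h : mu ζ = mu ζ') : ∃ r, ζ' = translate r ζ := by
  have hb : ζ.base = ζ'.base := congrArg VDual.base h
  set c : AdaptedChart n π := chartAround π ζ.base
  have hs : ζ.base ∈ c.e.source := mem_chartAround _
  have hs' : ζ'.base ∈ c.e.source := hb ▸ hs
  have h1 := congrArg c.vdualChart h
  rw [vdualChart_mu _ c hs, vdualChart_mu _ c hs'] at h1
  refine ⟨(c.cotanChart ζ').2.1 - (c.cotanChart ζ).2.1, c.cotanChart.injOn hs' hs ?_⟩
  rw [cotanChart_translate ζ c hs]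
  have h2 := congrArg Prod.fst h1
  have h3 := congrArg Prod.snd h1
  dsimp only at h2 h3
  refine Prod.ext ?_ (Prod.ext ?_ ?_)
  · simp [h2]
  · simp
  · simp [h3]

theorem translate_injective {r s : ℝ} (h : translate r ζ = translate s ζ) : r = s := by
  set c : AdaptedChart n π := chartAround π ζ.base
  have h1 := congrArg c.cotanChart h
  rw [cotanChart_translate ζ c (mem_chartAround _), cotanChart_translate ζ c (mem_chartAround _)] at h1
  simpa using congrArg (fun z => z.2.1) h1

theorem exists_mu_eq (ξ : VDual n π) : ∃ ζ : Cotan n π, mu ζ = ξ := by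
  set c : AdaptedChart n π := chartAround π ξ.base
  have hs : ξ.base ∈ c.e.source := mem_chartAround _
  have hξ : c.vdualChart ξ ∈ c.vdualChart.target := c.vdualChart.map_source hs
  have ht : ((c.vdualChart ξ).1, ((0 : ℝ), (c.vdualChart ξ).2)) ∈ c.cotanChart.target :=
    ⟨hξ.1, mem_univ _⟩
  have hζ := c.cotanChart.map_target ht
  refine ⟨c.cotanChart.symm ((c.vdualChart ξ).1, (0, (c.vdualChart ξ).2)), ?_⟩
  refine c.vdualChart.injOn hζ hs ?_
  rw [vdualChart_mu _ c hζ, c.cotanChart.right_inv ht]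

theorem dtranslate_apply (r : ℝ) (X : Base n × Base n) :
    mfderiv 𝓘(ℝ, Base n × Base n) 𝓘(ℝ, Base n × Base n) (translate r) ζ X = X := by
  rw [(hasMFDerivAt_translate ζ r).mfderiv]; rfl

theorem phi_sameOrbit {A B : UnitForm n π} (h : SameOrbit A B) : phi A = phi B := by
  obtain ⟨ζ, γ₀, h₀⟩ := A
  obtain ⟨r, γ, hγ, rfl, h⟩ := h
  apply Subtype.ext
  dsimp only at γ hγ h ⊢
  have key : ∀ X : Base n × Base n, symp ζ X = γ₀ → symp (translate r ζ) X = γ := by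
    intro X hX
    refine ContinuousLinearMap.ext fun Y => ?_
    have h1 : symp ζ X Y = γ (mfderiv 𝓘(ℝ, Base n × Base n) 𝓘(ℝ, Base n × Base n) (translate r) ζ Y) :=
      DFunLike.congr_fun (hX.trans h) (id Y : Base n × Base n)
    have h2 : γ (mfderiv 𝓘(ℝ, Base n × Base n) 𝓘(ℝ, Base n × Base n) (translate r) ζ Y) = γ Y :=
      congrArg γ (dtranslate_apply ζ r Y)
    refine ((symp_eq (translate r ζ) X Y).trans (symp_eq ζ X Y).symm).trans (h1.trans h2)
  have h3 : sympInv (translate r ζ) γ = sympInv ζ γ₀ := by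
    rw [← key _ (symp_sympInv ζ γ₀)]
    exact sympInv_symp _ _
  have h4 : dmu (translate r ζ) (sympInv (translate r ζ) γ) = dmu ζ (sympInv ζ γ₀) :=
    (congrArg (dmu (translate r ζ)) h3).trans
      ((dmu_apply (translate r ζ) _).trans (dmu_apply ζ _).symm)
  exact (mk_eq_mk (mu_translate ζ r).symm _).trans
    (congrArg (Bundle.TotalSpace.mk (mu (translate r ζ))) h4.symm)

/-- The map `Pμ → J¹π₁*` induced by `φ`. -/
def phiBar : PhaseBundle n π → jetSet n π := Quot.lift phi fun _ _ => phi_sameOrbit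

theorem phiBar_sameModTime {P Q : PhaseBundle n π} (h : SameModTime P Q) : phiBar P = phiBar Q := by
  obtain ⟨A, r, h, rfl, rfl⟩ := h
  apply Subtype.ext
  change (⟨mu A.pt, _⟩ : TangentBundle 𝓘(ℝ, Base n × (Fin n → ℝ)) (VDual n π)) = ⟨mu A.pt, _⟩
  congr 1
  have h1 : (dtime (mu A.pt)).comp (dmu A.pt) = - symp A.pt (genVec A.pt) :=
    ContinuousLinearMap.ext fun X => by
      have := symp_genVec A.pt X
      simp [this]
  have h2 : sympInv A.pt (A.form + r • (dtime (mu A.pt)).comp (dmu A.pt)) =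
      sympInv A.pt A.form - r • genVec A.pt := by
    rw [h1, map_add, map_smul, map_neg, sympInv_symp, smul_neg, sub_eq_add_neg]
  refine Eq.trans ?_ (congrArg (dmu A.pt) h2).symm
  rw [map_sub, map_smul, dmu_genVec, smul_zero, sub_zero]

/-- The map `φ̃ : Pμ / ⟨dπ₁*⟩ → J¹π₁*` induced by `φ`. -/
def phiTilde : ReducedPhase n π → jetSet n π := Quot.lift phiBar fun _ _ => phiBar_sameModTime

theorem phiTilde_injective : Function.Injective (phiTilde (n := n) (π := π)) := by
  rintro ⟨⟨A⟩⟩ ⟨⟨B⟩⟩ (h : phi A = phi B)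
  obtain ⟨ζ, α, hα⟩ := A
  obtain ⟨ζ', γ, hγ⟩ := B
  have hmu : mu ζ = mu ζ' := congrArg (fun v : jetSet n π => v.1.proj) h
  obtain ⟨r, rfl⟩ := exists_translate hmu
  let α' : TangentSpace 𝓘(ℝ, Base n × Base n) ζ →L[ℝ] ℝ :=
    γ.comp (mfderiv 𝓘(ℝ, Base n × Base n) 𝓘(ℝ, Base n × Base n) (translate r) ζ)
  have hα' : α' (genVec ζ) = 1 := by
    refine Eq.trans ?_ hγ
    refine congrArg γ ?_
    exact (congrArg _ (genVec_eq ζ)).trans ((dtranslate_apply ζ r _).trans (genVec_eq (translate r ζ)).symm)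
  have horb : SameOrbit ⟨ζ, α', hα'⟩ ⟨translate r ζ, γ, hγ⟩ := ⟨r, γ, hγ, rfl, rfl⟩
  have hphi : phi ⟨ζ, α, hα⟩ = phi ⟨ζ, α', hα'⟩ := h.trans (phi_sameOrbit horb).symm
  have h2 : dmu ζ (sympInv ζ α) = dmu ζ (sympInv ζ α') := by
    have h0 := congrArg Subtype.val hphi
    exact eq_of_heq (Bundle.TotalSpace.mk.inj h0).2
  obtain ⟨s, hs⟩ := dmu_eq_zero ζ (X := sympInv ζ α - sympInv ζ α') (by rw [map_sub, h2, sub_self])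
  have h3 : α' = α + s • (dtime (mu ζ)).comp (dmu ζ) := by
    have h4 := congrArg (symp ζ) hs
    rw [map_sub, symp_sympInv, symp_sympInv, map_smul] at h4
    refine ContinuousLinearMap.ext fun X => ?_
    have h5 := DFunLike.congr_fun h4 X
    have h6 := symp_genVec ζ X
    simp only [sub_apply, smul_apply, h6, smul_eq_mul] at h5
    simp only [add_apply, smul_apply, smul_eq_mul,
      ContinuousLinearMap.comp_apply]
    linarith
  have hrel : SameModTime (Quot.mk _ ⟨ζ, α, hα⟩ : PhaseBundle n π) (Quot.mk _ ⟨ζ, α', hα'⟩) := by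
    refine ⟨⟨ζ, α, hα⟩, s, ?_, rfl, ?_⟩
    · exact (congrArg (fun f => f (genVec ζ)) h3.symm).trans hα'
    · congr 2
  refine (Quot.sound hrel).trans ?_
  exact congrArg (Quot.mk _) (Quot.sound horb)

theorem phiTilde_surjective : Function.Surjective (phiTilde (n := n) (π := π)) := by
  rintro ⟨⟨ξ, X⟩, hX⟩
  obtain ⟨ζ, rfl⟩ := exists_mu_eq ξ
  let Y : Base n × Base n := ((id X : Base n × (Fin n → ℝ)).1, (0, (id X : Base n × (Fin n → ℝ)).2))
  have hY : dmu ζ Y = X := dmu_apply ζ Y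
  have h1 : symp ζ Y (genVec ζ) = 1 := by
    refine (symp_genVec_right ζ Y).trans ?_
    rw [hY]; exact hX
  refine ⟨Quot.mk _ (Quot.mk _ ⟨ζ, symp ζ Y, h1⟩), Subtype.ext ?_⟩
  have h2 : dmu ζ (sympInv ζ (symp ζ Y)) = X := (congrArg (dmu ζ) (sympInv_symp ζ Y)).trans hY
  exact congrArg (Bundle.TotalSpace.mk (mu ζ)) h2

variable (n π) in
/-- The bijection `b_π = φ̃⁻¹ : J¹π₁* → Pμ / ⟨dπ₁*⟩`. -/
def bPi : jetSet n π ≃ ReducedPhase n π :=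
  (Equiv.ofBijective phiTilde ⟨phiTilde_injective, phiTilde_surjective⟩).symm


/-! ### Hamiltonian sections -/

variable (n π) in
/-- A Hamiltonian section: a smooth section `h : V*π → T*M` of `μ`. -/
structure HamiltonianSection where
  toFun : VDual n π → Cotan n π
  contMDiff : ContMDiff 𝓘(ℝ, Base n × (Fin n → ℝ)) 𝓘(ℝ, Base n × Base n) ∞ toFun
  mu_toFun : ∀ ξ, mu (toFun ξ) = ξ

namespace HamiltonianSection

variable (h : HamiltonianSection n π)

theorem exists_eq_translate (ζ : Cotan n π) : ∃ r, ζ = translate r (h.toFun (mu ζ)) :=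
  exists_translate (h.mu_toFun (mu ζ))

/-- The function `F_h` on `T*M` with `V_μ(F_h) = 1` which vanishes on the image of `h`:
`ζ = h(μ(ζ)) + F_h(ζ) dπ`. -/
def potential (ζ : Cotan n π) : ℝ := (h.exists_eq_translate ζ).choose

theorem eq_translate (ζ : Cotan n π) : ζ = translate (h.potential ζ) (h.toFun (mu ζ)) :=
  (h.exists_eq_translate ζ).choose_spec

theorem translate_translate (r s : ℝ) : translate r (translate s ζ) = translate (s + r) ζ := by
  have key : (translate r (translate s ζ)).form = (translate (s + r) ζ).form :=
    ContinuousLinearMap.ext fun u => by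
      change ζ.form u + s * dpi n π ζ.base u + r * dpi n π ζ.base u =
        ζ.form u + (s + r) * dpi n π ζ.base u
      ring
  exact congrArg (fun l : TangentSpace 𝓘(ℝ, Base n) ζ.base →L[ℝ] ℝ => (⟨ζ.base, l⟩ : Cotan n π)) key

theorem potential_translate (r : ℝ) : h.potential (translate r ζ) = h.potential ζ + r := by
  have h1 := h.eq_translate (translate r ζ)
  rw [mu_translate] at h1
  have h2 := congrArg (translate r) (h.eq_translate ζ)
  rw [translate_translate] at h2
  exact translate_injective _ (h1.symm.trans h2)

theorem mdifferentiableAt_cotanChart (c : AdaptedChart n π) {ζ : Cotan n π}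
    (hζ : ζ.base ∈ c.e.source) :
    MDifferentiableAt 𝓘(ℝ, Base n × Base n) 𝓘(ℝ, Base n × Base n) c.cotanChart ζ := by
  have hmem : (cotanCore n π).openPartialHomeomorph c.cotanChart ⟨c, rfl⟩ ∈
      atlas (Base n × Base n) (Cotan n π) :=
    mem_iUnion.2 ⟨c.cotanChart, mem_iUnion.2 ⟨⟨c, rfl⟩, rfl⟩⟩
  exact mdifferentiableAt_atlas hmem hζ

theorem mdifferentiableAt_potential :
    MDifferentiableAt 𝓘(ℝ, Base n × Base n) 𝓘(ℝ, ℝ) h.potential ζ := by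
  set c : AdaptedChart n π := chartAround π ζ.base
  have hbase : ∀ y : Cotan n π, (h.toFun (mu y)).base = y.base := fun y =>
    congrArg VDual.base (h.mu_toFun (mu y))
  have hs : ζ.base ∈ c.e.source := mem_chartAround _
  let P : Base n × Base n →L[ℝ] ℝ := (ContinuousLinearMap.fst ℝ ℝ (Fin n → ℝ)).comp
    (ContinuousLinearMap.snd ℝ (Base n) (Base n))
  have h1 : MDifferentiableAt 𝓘(ℝ, Base n × Base n) 𝓘(ℝ, ℝ) (fun y => P (c.cotanChart y)) ζ :=
    P.mdifferentiableAt.comp ζ (mdifferentiableAt_cotanChart c hs)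
  have h2 : MDifferentiableAt 𝓘(ℝ, Base n × Base n) 𝓘(ℝ, ℝ)
      (fun y => P (c.cotanChart (h.toFun (mu y)))) ζ := by
    have h3 : MDifferentiableAt 𝓘(ℝ, Base n × Base n) 𝓘(ℝ, Base n × Base n)
        (fun y => h.toFun (mu y)) ζ :=
      ((h.contMDiff.mdifferentiable (by simp)) (mu ζ)).comp ζ (hasMFDerivAt_mu ζ).mdifferentiableAt
    have h4 : MDifferentiableAt 𝓘(ℝ, Base n × Base n) 𝓘(ℝ, Base n × Base n) c.cotanChart
        (h.toFun (mu ζ)) := mdifferentiableAt_cotanChart c (by rw [hbase]; exact hs)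
    exact P.mdifferentiableAt.comp ζ (h4.comp ζ h3)
  refine (h1.sub h2).congr_of_eventuallyEq ?_
  filter_upwards [eventually_cotan ζ] with y hy
  have h5 := congrArg (fun z => P (c.cotanChart z)) (h.eq_translate y)
  have h6 := congrArg P (cotanChart_translate (h.toFun (mu y)) c (by rw [hbase]; exact hy)
    (h.potential y))
  have h7 := h5.trans h6
  rw [map_add] at h7
  change h.potential y = P (c.cotanChart y) - P (c.cotanChart (h.toFun (mu y)))
  rw [show P (c.cotanChart y) = _ from h7]
  simp [P]

/-- The differential `dF_h`. -/
def dpotential (ζ : Cotan n π) : TangentSpace 𝓘(ℝ, Base n × Base n) ζ →L[ℝ] ℝ :=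
  mfderiv 𝓘(ℝ, Base n × Base n) 𝓘(ℝ, ℝ) h.potential ζ

theorem dpotential_genVec : h.dpotential ζ (genVec ζ) = 1 := by
  have h0 : translate 0 ζ = ζ := by simp [translate]
  have h1 := mfderiv_comp_apply (I := 𝓘(ℝ, ℝ)) (I' := 𝓘(ℝ, Base n × Base n)) (I'' := 𝓘(ℝ, ℝ))
    (g := h.potential) (f := fun r : ℝ => translate r ζ) (0 : ℝ)
    (h.mdifferentiableAt_potential (translate 0 ζ)) (hasMFDerivAt_line ζ).mdifferentiableAt (1 : ℝ)
  have h2 : h.potential ∘ (fun r : ℝ => translate r ζ) = fun r => h.potential ζ + r :=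
    funext fun r => h.potential_translate ζ r
  rw [h2, mfderiv_eq_fderiv] at h1
  have h3 : (fderiv ℝ (fun r => h.potential ζ + r) 0) 1 = (1 : ℝ) := by simp
  have h4 : ∀ ζ' : Cotan n π, ζ' = ζ → h.dpotential ζ' (genVec ζ : Base n × Base n) =
      h.dpotential ζ (genVec ζ) := by
    rintro _ rfl; rfl
  exact (h4 _ h0).symm.trans (h1.symm.trans h3)

/-- The section `dh : V*π → Pμ` induced by the equivariant section `dF_h` of `V̂_μ⁻¹(1)`, computed
at the point `h(ξ)` over `ξ`. -/
def dh (ξ : VDual n π) : PhaseBundle n π :=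
  Quot.mk _ ⟨h.toFun ξ, h.dpotential (h.toFun ξ), h.dpotential_genVec (h.toFun ξ)⟩

/-- The section `d̃h : V*π → Pμ / ⟨dπ₁*⟩`. -/
def dhTilde (ξ : VDual n π) : ReducedPhase n π := Quot.mk _ (h.dh ξ)

/-- The local Hamiltonian `H(t, q, p)` in an adapted chart: `h(t, q, p) = (t, q, -H(t, q, p), p)`. -/
def localHamiltonian (c : AdaptedChart n π) (z : Base n × (Fin n → ℝ)) : ℝ :=
  -(c.cotanChart (h.toFun (c.vdualChart.symm z))).2.1

/-- `∂H/∂qⁱ`. -/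
def partialQ (c : AdaptedChart n π) (i : Fin n) (z : Base n × (Fin n → ℝ)) : ℝ :=
  fderiv ℝ (h.localHamiltonian c) z ((0, Pi.single i 1), 0)

/-- `∂H/∂p_i`. -/
def partialP (c : AdaptedChart n π) (i : Fin n) (z : Base n × (Fin n → ℝ)) : ℝ :=
  fderiv ℝ (h.localHamiltonian c) z ((0, 0), Pi.single i 1)

/-- The local section `τ`, defined on `U`, satisfies the Hamilton equations
`dqⁱ/dt = ∂H/∂p_i`, `dp_i/dt = -∂H/∂qⁱ` in all adapted coordinates. -/
def IsSolution (τ : ℝ → VDual n π) (U : Set ℝ) : Prop :=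
  ∀ c : AdaptedChart n π, ∀ t ∈ U, (τ t).base ∈ c.e.source → ∀ i,
    HasDerivAt (fun s => (c.vdualChart (τ s)).1.2 i) (h.partialP c i (c.vdualChart (τ t))) t ∧
    HasDerivAt (fun s => (c.vdualChart (τ s)).2 i) (-h.partialQ c i (c.vdualChart (τ t))) t

/-- The subset `S_h = b_π⁻¹(d̃h(V*π))` of `J¹π₁* ⊆ T(V*π)`. -/
def lagr : Set (TangentBundle 𝓘(ℝ, Base n × (Fin n → ℝ)) (VDual n π)) :=
  Subtype.val '' ((bPi n π).symm '' range h.dhTilde)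

/-- The functions `(q̇ⁱ - ∂H/∂p_i, ṗ_i + ∂H/∂qⁱ)` of the coordinates `(t, qⁱ, p_i, q̇ⁱ, ṗ_i)` of
`v ∈ J¹π₁*`. -/
def residual (c : AdaptedChart n π)
    (v : TangentBundle 𝓘(ℝ, Base n × (Fin n → ℝ)) (VDual n π)) : (Fin n → ℝ) × (Fin n → ℝ) :=
  let z := c.vdualChart v.proj
  let z' : Base n × (Fin n → ℝ) :=
    mfderiv 𝓘(ℝ, Base n × (Fin n → ℝ)) 𝓘(ℝ, Base n × (Fin n → ℝ)) c.vdualChart v.proj v.2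
  (fun i => z'.1.2 i - h.partialP c i z, fun i => z'.2 i + h.partialQ c i z)

end HamiltonianSection

/-- The domain in `T(V*π)` of the coordinates induced by an adapted chart. -/
def AdaptedChart.domain (c : AdaptedChart n π) :
    Set (TangentBundle 𝓘(ℝ, Base n × (Fin n → ℝ)) (VDual n π)) :=
  {v | v.proj.base ∈ c.e.source}

/-- The jet prolongation `j¹τ(t) = τ'(t)`. -/
def jetProlong (τ : ℝ → VDual n π) (t : ℝ) :
    TangentBundle 𝓘(ℝ, Base n × (Fin n → ℝ)) (VDual n π) :=
  ⟨τ t, mfderiv 𝓘(ℝ, ℝ) 𝓘(ℝ, Base n × (Fin n → ℝ)) τ t (1 : ℝ)⟩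

end Phase

section Poisson

/-! ### Bivector fields and Lagrangian submanifolds -/

/-- A 2-vector field `Λ`, given by its sharp map `Λ♯ : T*N → TN`, `Λ♯(α) = Λ(α, -)`. -/
abbrev SharpField (E N : Type*) [NormedAddCommGroup E] [NormedSpace ℝ E] [TopologicalSpace N]
    [ChartedSpace E N] : Type _ :=
  ∀ x : N, (TangentSpace 𝓘(ℝ, E) x →L[ℝ] ℝ) →L[ℝ] TangentSpace 𝓘(ℝ, E) x

variable {E N : Type*} [NormedAddCommGroup E] [NormedSpace ℝ E] [TopologicalSpace N]
    [ChartedSpace E N]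

/-- The sharp map in the chart at `x₀`. -/
def SharpField.inChart (P : SharpField E N) (x₀ : N) (y : E) : (E →L[ℝ] ℝ) →L[ℝ] E :=
  let A : TangentSpace 𝓘(ℝ, E) ((chartAt E x₀).symm y) →L[ℝ] E :=
    mfderiv 𝓘(ℝ, E) 𝓘(ℝ, E) (chartAt E x₀) ((chartAt E x₀).symm y)
  A.comp ((P ((chartAt E x₀).symm y)).comp (ContinuousLinearMap.precomp ℝ A))

/-- The complete lift to `TN` of `Λ = ½ Λⁱʲ ∂/∂xⁱ ∧ ∂/∂xʲ`, that is
`Λᶜ = Λⁱʲ ∂/∂xⁱ ∧ ∂/∂ẋʲ + ½ ẋᵏ (∂Λⁱʲ/∂xᵏ) ∂/∂ẋⁱ ∧ ∂/∂ẋʲ`. In terms of sharp maps, the covector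
`a dx + b dẋ` at `(x, ẋ)` is mapped to `(Λ♯ b, Λ♯ a + (D_ẋ Λ♯) b)`. -/
def SharpField.completeLift [IsManifold 𝓘(ℝ, E) 1 N] (P : SharpField E N)
    (v : TangentBundle 𝓘(ℝ, E) N) :
    (TangentSpace 𝓘(ℝ, E).tangent v →L[ℝ] ℝ) →L[ℝ] TangentSpace 𝓘(ℝ, E).tangent v :=
  let x : E := chartAt E v.proj v.proj
  let ra : (E × E →L[ℝ] ℝ) →L[ℝ] (E →L[ℝ] ℝ) :=
    ContinuousLinearMap.precomp ℝ (ContinuousLinearMap.inl ℝ E E)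
  let rb : (E × E →L[ℝ] ℝ) →L[ℝ] (E →L[ℝ] ℝ) :=
    ContinuousLinearMap.precomp ℝ (ContinuousLinearMap.inr ℝ E E)
  let L : E →L[ℝ] (E →L[ℝ] ℝ) →L[ℝ] E := fderiv ℝ (P.inChart v.proj) x
  let w : E := v.2
  (((P.inChart v.proj x).comp rb).prod ((P.inChart v.proj x).comp ra + (L w).comp rb) :
    (E × E →L[ℝ] ℝ) →L[ℝ] E × E)

variable {F H : Type*} [NormedAddCommGroup F] [NormedSpace ℝ F] [TopologicalSpace H]
  (I : ModelWithCorners ℝ F H) {X : Type*} [TopologicalSpace X] [ChartedSpace H X]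

/-- The tangent space at `x` of a submanifold `C`: spanned by the velocities of the curves in `C`
through `x`. -/
def tangentTo (C : Set X) (x : X) : Submodule ℝ (TangentSpace I x) :=
  Submodule.span ℝ {w | ∃ γ : ℝ → X, γ 0 = x ∧ (∀ᶠ t in 𝓝 0, γ t ∈ C) ∧
    MDifferentiableAt 𝓘(ℝ, ℝ) I γ 0 ∧ mfderiv 𝓘(ℝ, ℝ) I γ 0 (1 : ℝ) = (w : F)}

/-- On the open set `U`, the subset `C` of the submanifold `J` is defined by the equation `f = 0`,
where `f` is smooth and is a submersion on `J`. -/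
structure IsDefinedBy {G : Type*} [NormedAddCommGroup G] [NormedSpace ℝ G] (J C U : Set X)
    (f : X → G) : Prop where
  isOpen : IsOpen U
  contMDiffOn : ContMDiffOn I 𝓘(ℝ, G) ∞ f U
  submersive : ∀ x ∈ J ∩ U, ∀ g : G, ∃ w ∈ tangentTo I J x, mfderiv I 𝓘(ℝ, G) f x w = g
  eq_zeros : C ∩ U = {x ∈ J ∩ U | f x = 0}

/-- `C` is an embedded submanifold of the submanifold `J`. -/
def IsSubmanifold (J C : Set X) : Prop :=
  C ⊆ J ∧ ∃ m : ℕ, ∀ x ∈ C, ∃ (U : Set X) (f : X → (Fin m → ℝ)), x ∈ U ∧ IsDefinedBy I J C U f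

/-- A subspace `L` of a vector space `V` with a 2-vector `Λ` is Lagrangian: `Λ(α, β) = 0` for
`α, β ∈ (Λ♯)⁻¹(L)` and `dim (L ∩ Λ♯(V*)) = ½ dim Λ♯(V*)`. -/
def IsLagrangianSubspace {V : Type*} [AddCommGroup V] [Module ℝ V]
    (S : Module.Dual ℝ V →ₗ[ℝ] V) (L : Submodule ℝ V) : Prop :=
  (∀ α β : Module.Dual ℝ V, S α ∈ L → S β ∈ L → β (S α) = 0) ∧
  2 * Module.finrank ℝ (L ⊓ LinearMap.range S : Submodule ℝ V) =
    Module.finrank ℝ (LinearMap.range S)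

end Poisson

section Jet

variable {n : ℕ} {M : Type*} [TopologicalSpace M] [ChartedSpace (Base n) M] {π : M → ℝ}
  [IsManifold 𝓘(ℝ, Base n) ∞ M] [IsFibration n π]

variable (n π) in
/-- The canonical Poisson structure of `V*π`, the image under `μ` of the Poisson structure of the
symplectic manifold `T*M` (whose sharp map is `-b_Ω⁻¹`): `Λ♯ = -Tμ ∘ b_Ω⁻¹ ∘ (Tμ)*`, computed at
any point of `T*M` over `ξ`. In adapted coordinates, `Λ = ∂/∂qⁱ ∧ ∂/∂p_i`. -/
def poissonV : SharpField (Base n × (Fin n → ℝ)) (VDual n π) := fun ξ =>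
  let ζ : Cotan n π := (exists_mu_eq ξ).choose
  have hζ : mu ζ = ξ := (exists_mu_eq ξ).choose_spec
  hζ ▸ (-(dmu ζ).comp ((sympInv ζ).comp (ContinuousLinearMap.precomp ℝ (dmu ζ))))

variable (n π) in
/-- The sharp map of the Poisson structure `Λ_{J¹π₁*}` on `J¹π₁*`, the restriction of the complete
lift of `Λ_{V*π}`, at a point `v` of `J¹π₁*`. A covector on `T_v(J¹π₁*)` is extended to `T_v(T(V*π))`
by means of a linear retraction `r`. The complete lift is tangent to `J¹π₁*`: its sharp map takes
values in `T_v(J¹π₁*)`, where `r` is the identity, and kills the annihilator of `T_v(J¹π₁*)`, so that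
the choice of `r` does not matter. -/
def poissonJet (v : TangentBundle 𝓘(ℝ, Base n × (Fin n → ℝ)) (VDual n π)) :
    Module.Dual ℝ (tangentTo 𝓘(ℝ, Base n × (Fin n → ℝ)).tangent (jetSet n π) v) →ₗ[ℝ]
      tangentTo 𝓘(ℝ, Base n × (Fin n → ℝ)).tangent (jetSet n π) v :=
  let T := tangentTo 𝓘(ℝ, Base n × (Fin n → ℝ)).tangent (jetSet n π) v
  let r : (Base n × (Fin n → ℝ)) × (Base n × (Fin n → ℝ)) →ₗ[ℝ] T :=
    (LinearMap.exists_leftInverse_of_injective T.subtype T.ker_subtype).choose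
  let S : ((Base n × (Fin n → ℝ)) × (Base n × (Fin n → ℝ)) →L[ℝ] ℝ) →ₗ[ℝ]
      (Base n × (Fin n → ℝ)) × (Base n × (Fin n → ℝ)) :=
    ((poissonV n π).completeLift v).toLinearMap
  r ∘ₗ S ∘ₗ LinearMap.toContinuousLinearMap.toLinearMap ∘ₗ Module.Dual.transpose (R := ℝ) r

/-- `C` is a Lagrangian submanifold of the Poisson manifold `(J¹π₁*, Λ_{J¹π₁*})`. -/
def IsLagrangianInJet (C : Set (TangentBundle 𝓘(ℝ, Base n × (Fin n → ℝ)) (VDual n π))) : Prop :=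
  IsSubmanifold 𝓘(ℝ, Base n × (Fin n → ℝ)).tangent (jetSet n π) C ∧
  ∀ v ∈ C, IsLagrangianSubspace (poissonJet n π v)
    ((tangentTo 𝓘(ℝ, Base n × (Fin n → ℝ)).tangent C v).comap
      (tangentTo 𝓘(ℝ, Base n × (Fin n → ℝ)).tangent (jetSet n π) v).subtype)

end Jet

end TimeDep

end

open TimeDep

/-!
Everything reduces to one computation in an adapted chart. The canonical charts `(t, qⁱ, p_t, p_i)`
of `T*M` are symplectic: a change of charts preserves the Liouville form
(`AdaptedChart.stdLiouville_trans`), hence its exterior derivative, because second derivatives are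
symmetric (`skew_pullback_of_pullback`). So `Tμ ∘ b_Ω⁻¹` has the same expression in all of them
(`AdaptedChart.dvdual_dmu_sympInv`), with two consequences.

* The Poisson structure of `V*π` is `Λ = ∂/∂qⁱ ∧ ∂/∂p_i` in every adapted chart
  (`AdaptedChart.dvdual_poissonV`).
* As `F_h = p_t + H`, the section `b_π⁻¹ ∘ d̃h` of `J¹π₁*` is the vector field
  `X = ∂/∂t + (∂H/∂p_i) ∂/∂qⁱ - (∂H/∂qⁱ) ∂/∂p_i` in every adapted chart
  (`HamiltonianSection.dvdual_bPi_symm`).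

Therefore `S_h` is the image of `X`, that is, the zero set in `J¹π₁*` of the functions
`q̇ⁱ - ∂H/∂p_i`, `ṗ_i + ∂H/∂qⁱ`, and the curves `τ` with `j¹τ = X ∘ τ` are the solutions of the Hamilton
equations (`HamiltonianSection.isSolution_iff`). These functions are affine on the fibres of
`J¹π₁* → V*π`, with linear part the coordinates of the fibre, so they are independent
(`HamiltonianSection.exists_mfderiv_residual_eq`).

Since `Λ` has constant coefficients, its complete lift maps `a dx + b dẋ` to `(Λ♯ b, Λ♯ a)`
(`completeLift_poissonV`), and the tangent space of `J¹π₁*` is the hyperplane `dṫ = 0`. The tangent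
space of `S_h` is the graph of `DX`. As `X = ∂/∂t - Λ♯(dH)`, it is the graph of `-Λ♯ ∘ B` with `B` the
Hessian of `H`, and such a graph is Lagrangian because `B` is symmetric
(`isLagrangianSubspace_graph`).
-/

noncomputable section

set_option linter.unusedSectionVars false

namespace TimeDep

/-- The model space of `V*π`, with coordinates `(t, qⁱ, p_i)`. -/
abbrev Fiber (n : ℕ) : Type := Base n × (Fin n → ℝ)

/-! ### The canonical structures in coordinates -/

section Model

/-- If `F` preserves the 1-form `θ` (with linear coefficients), it preserves its exterior
derivative: the second derivative of `F` contributes a symmetric term only. -/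
theorem skew_pullback_of_pullback {E : Type*} [NormedAddCommGroup E] [NormedSpace ℝ E]
    (θ : E →L[ℝ] E →L[ℝ] ℝ) {F : E → E} {z : E} (hF : ContDiffAt ℝ ∞ F z)
    (h : ∀ᶠ y in 𝓝 z, ∀ Y, θ (F y) (fderiv ℝ F y Y) = θ y Y) (X Y : E) :
    θ (fderiv ℝ F z X) (fderiv ℝ F z Y) - θ (fderiv ℝ F z Y) (fderiv ℝ F z X) =
      θ X Y - θ Y X := by
  have hd : HasFDerivAt (fderiv ℝ F) (fderiv ℝ (fderiv ℝ F) z) z :=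
    ((hF.fderiv_right (m := ∞) (by simp)).differentiableAt (by simp)).hasFDerivAt
  have h1 := (θ.hasFDerivAt.comp z (hF.differentiableAt (by simp)).hasFDerivAt).clm_comp hd
  have h2 : HasFDerivAt (fun y => ((⇑θ ∘ F) y).comp (fderiv ℝ F y)) θ z := by
    refine θ.hasFDerivAt.congr_of_eventuallyEq ?_
    filter_upwards [h] with y hy
    exact ContinuousLinearMap.ext hy
  have h3 := h1.unique h2
  have hs : IsSymmSndFDerivAt ℝ F z := hF.isSymmSndFDerivAt
    (by simp; exact WithTop.coe_le_coe.2 le_top)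
  -- `X(θ(F_* Y))` and `Y(θ(F_* X))`; the terms with `D²F` cancel in the difference.
  have a1 := DFunLike.congr_fun (DFunLike.congr_fun h3 X) Y
  have a2 := DFunLike.congr_fun (DFunLike.congr_fun h3 Y) X
  have a3 := hs X Y
  simp at a1 a2
  rw [a3] at a1
  linarith

variable {n : ℕ}

/-- The Liouville form `p_t dt + p_i dqⁱ` of `T*(ℝ × ℝⁿ)`. -/
def stdLiouville (n : ℕ) : (Base n × Base n) →L[ℝ] (Base n × Base n →L[ℝ] ℝ) :=
  LinearMap.toContinuousLinearMap
    { toFun := fun z => (ofCoeffs z.2).comp (ContinuousLinearMap.fst ℝ (Base n) (Base n))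
      map_add' := fun z w => ContinuousLinearMap.ext fun v => by
        simp [ofCoeffs_apply, add_mul, Finset.sum_add_distrib]; ring
      map_smul' := fun z w => ContinuousLinearMap.ext fun v => by
        simp [ofCoeffs_apply, mul_add, Finset.mul_sum, mul_assoc] }

theorem stdLiouville_apply (X Y : Base n × Base n) : stdLiouville n X Y = ofCoeffs X.2 Y.1 := rfl

/-- A vector which `Ω = dt ∧ dp_t + dqⁱ ∧ dp_i` pairs to the covector `β` has the components
prescribed by the Hamilton equations. -/
theorem eq_of_stdSymp_eq {X : Base n × Base n} {β : Base n × Base n →L[ℝ] ℝ}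
    (h : ∀ Y : Base n × Base n, ofCoeffs Y.2 X.1 - ofCoeffs X.2 Y.1 = β Y) :
    ((X.1, X.2.2) : Fiber n) =
      ((β (0, (1, 0)), fun i => β (0, (0, Pi.single i 1))),
        fun i => -β ((0, Pi.single i 1), 0)) := by
  refine Prod.ext (Prod.ext ?_ (funext fun i => ?_)) (funext fun i => ?_)
  · simpa [ofCoeffs_apply] using h (0, (1, 0))
  · simpa [ofCoeffs_apply, Pi.single_apply] using h (0, (0, Pi.single i 1))
  · have := h ((0, Pi.single i 1), 0)
    simp only [ofCoeffs_apply, Pi.single_apply] at this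
    simp only [← this]
    simp

/-- The sharp map `α ↦ α(∂/∂qⁱ) ∂/∂p_i - α(∂/∂p_i) ∂/∂qⁱ` of `∂/∂qⁱ ∧ ∂/∂p_i`. -/
def stdSharp (n : ℕ) : (Fiber n →L[ℝ] ℝ) →L[ℝ] Fiber n :=
  (((0 : (Fiber n →L[ℝ] ℝ) →L[ℝ] ℝ)).prod
    (ContinuousLinearMap.pi fun i => -ContinuousLinearMap.apply ℝ ℝ
      (((0, 0), Pi.single i 1) : Fiber n))).prod
    (ContinuousLinearMap.pi fun i => ContinuousLinearMap.apply ℝ ℝ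
      (((0, Pi.single i 1), 0) : Fiber n))

theorem stdSharp_apply (α : Fiber n →L[ℝ] ℝ) :
    stdSharp n α = ((0, fun i => -α ((0, 0), Pi.single i 1)), fun i => α ((0, Pi.single i 1), 0)) :=
  rfl

end Model

/-! ### Canonical charts of `T*M` are symplectic -/

section Transition

variable {n : ℕ} {M : Type*} [TopologicalSpace M] [ChartedSpace (Base n) M] {π : M → ℝ}

/-- `transDiff c c'` is the inverse of the differential of the change of charts from `c` to `c'`. -/
theorem AdaptedChart.transDiff_fderiv (c c' : AdaptedChart n π) {y : Base n}
    (hy : y ∈ (c.e.symm.trans c'.e).source) (v : Base n) :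
    c.transDiff c' y (fderiv ℝ (c'.e ∘ c.e.symm) y v) = v := by
  have h1 : c.e.symm y ∈ c'.e.source := hy.2
  have h0 : y ∈ c.e.target := hy.1
  have hy' : (c'.e ∘ c.e.symm) y ∈ (c'.e.symm.trans c.e).source :=
    ⟨c'.e.map_source h1, by
      change c'.e.symm (c'.e (c.e.symm y)) ∈ c.e.source
      rw [c'.e.left_inv h1]; exact c.e.map_target h0⟩
  have d1 := (((c.contDiffOn_trans c').contDiffAt
    ((c.e.symm.trans c'.e).open_source.mem_nhds hy)).differentiableAt (by simp)).hasFDerivAt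
  have d2 := (((c'.contDiffOn_trans c).contDiffAt
    ((c'.e.symm.trans c.e).open_source.mem_nhds hy')).differentiableAt (by simp)).hasFDerivAt
  have h3 : (c.e ∘ c'.e.symm) ∘ (c'.e ∘ c.e.symm) =ᶠ[𝓝 y] id := by
    filter_upwards [(c.e.symm.trans c'.e).open_source.mem_nhds hy] with z hz
    have h4 : c.e.symm z ∈ c'.e.source := hz.2
    have h5 : z ∈ c.e.target := hz.1
    change c.e (c'.e.symm (c'.e (c.e.symm z))) = z
    rw [c'.e.left_inv h4, c.e.right_inv h5]
  exact DFunLike.congr_fun ((d2.comp y d1).unique ((hasFDerivAt_id y).congr_of_eventuallyEq h3)) v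

/-- The Liouville form has the same expression in all canonical charts. -/
theorem AdaptedChart.stdLiouville_trans (c c' : AdaptedChart n π) {z : Base n × Base n}
    (hz : z ∈ (c.cotanChart.symm.trans c'.cotanChart).source) (Y : Base n × Base n) :
    stdLiouville n (c'.cotanChart (c.cotanChart.symm z))
      (fderiv ℝ (fun z => c'.cotanChart (c.cotanChart.symm z)) z Y) = stdLiouville n z Y := by
  have h1 : z.1 ∈ c.e.target := hz.1.1
  have h2 : c.e.symm z.1 ∈ c'.e.source := hz.2
  have hz' : z.1 ∈ (c.e.symm.trans c'.e).source := ⟨h1, h2⟩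
  have hd : DifferentiableAt ℝ (fun z => c'.cotanChart (c.cotanChart.symm z)) z :=
    ((c.cotanChart_contDiffOn c').contDiffAt
      ((c.cotanChart_isOpen c').mem_nhds hz)).differentiableAt (by simp)
  have hd' : DifferentiableAt ℝ (c'.e ∘ c.e.symm) z.1 := ((c.contDiffOn_trans c').contDiffAt
    ((c.e.symm.trans c'.e).open_source.mem_nhds hz')).differentiableAt (by simp)
  have h3 : (fderiv ℝ (fun z => c'.cotanChart (c.cotanChart.symm z)) z Y).1 =
      fderiv ℝ (c'.e ∘ c.e.symm) z.1 Y.1 := by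
    have a1 := (ContinuousLinearMap.fst ℝ (Base n) (Base n)).hasFDerivAt.comp z hd.hasFDerivAt
    have a2 := HasFDerivAt.comp z hd'.hasFDerivAt
      ((ContinuousLinearMap.fst ℝ (Base n) (Base n)).hasFDerivAt (x := z))
    exact DFunLike.congr_fun (a1.unique a2) Y
  have h4 : ofCoeffs (c'.cotanChart (c.cotanChart.symm z)).2 =
      (ofCoeffs z.2).comp (c.transDiff c' z.1) := by
    refine (ofCoeffs_coeffs _).trans (ContinuousLinearMap.ext fun v => ?_)
    refine congrArg (ofCoeffs z.2) ?_
    have := c.transDiff_eq c' (c.e.map_target h1) h2 v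
    rw [c.e.right_inv h1] at this
    exact this.symm
  rw [stdLiouville_apply, stdLiouville_apply, h3, h4]
  exact congrArg (ofCoeffs z.2) (c.transDiff_fderiv c' hz' Y.1)

variable [IsManifold 𝓘(ℝ, Base n) ∞ M] [IsFibration n π]

theorem AdaptedChart.exists_atlas_eq_vdualChart (c : AdaptedChart n π) :
    ∃ e ∈ atlas (Fiber n) (VDual n π), e.toPartialEquiv = c.vdualChart :=
  ⟨_, mem_iUnion.2 ⟨c.vdualChart, mem_iUnion.2 ⟨⟨c, rfl⟩, rfl⟩⟩, rfl⟩

theorem AdaptedChart.exists_atlas_eq_cotanChart (c : AdaptedChart n π) :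
    ∃ e ∈ atlas (Base n × Base n) (Cotan n π), e.toPartialEquiv = c.cotanChart :=
  ⟨_, mem_iUnion.2 ⟨c.cotanChart, mem_iUnion.2 ⟨⟨c, rfl⟩, rfl⟩⟩, rfl⟩

theorem AdaptedChart.mdifferentiableAt_vdualChart (c : AdaptedChart n π) {ξ : VDual n π}
    (hξ : ξ.base ∈ c.e.source) :
    MDifferentiableAt 𝓘(ℝ, Fiber n) 𝓘(ℝ, Fiber n) c.vdualChart ξ := by
  obtain ⟨e, he, h⟩ := c.exists_atlas_eq_vdualChart
  have h1 : (e : VDual n π → _) = c.vdualChart := congrArg PartialEquiv.toFun h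
  have h2 : ξ ∈ e.source := by rw [h]; exact hξ
  exact h1 ▸ mdifferentiableAt_atlas he h2

/-- The differential of the chart `(t, qⁱ, p_t, p_i)` of `T*M`. -/
def AdaptedChart.dcotan (c : AdaptedChart n π) (ζ : Cotan n π) :
    TangentSpace 𝓘(ℝ, Base n × Base n) ζ →L[ℝ] Base n × Base n :=
  mfderiv 𝓘(ℝ, Base n × Base n) 𝓘(ℝ, Base n × Base n) c.cotanChart ζ

/-- The differential of the chart `(t, qⁱ, p_i)` of `V*π`. -/
def AdaptedChart.dvdual (c : AdaptedChart n π) (ξ : VDual n π) :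
    TangentSpace 𝓘(ℝ, Fiber n) ξ →L[ℝ] Fiber n :=
  mfderiv 𝓘(ℝ, Fiber n) 𝓘(ℝ, Fiber n) c.vdualChart ξ

theorem bijective_mfderiv_of_mem_atlas {E N : Type*} [NormedAddCommGroup E] [NormedSpace ℝ E]
    [TopologicalSpace N] [ChartedSpace E N] [IsManifold 𝓘(ℝ, E) 1 N]
    {e : OpenPartialHomeomorph N E} (he : e ∈ atlas E N) {x : N} (hx : x ∈ e.source) :
    Function.Bijective (mfderiv 𝓘(ℝ, E) 𝓘(ℝ, E) e x) :=
  (mdifferentiable_of_mem_atlas he).mfderiv_bijective hx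

theorem AdaptedChart.dcotan_bijective (c : AdaptedChart n π) {ζ : Cotan n π}
    (hζ : ζ.base ∈ c.e.source) : Function.Bijective (c.dcotan ζ) := by
  obtain ⟨e, he, h⟩ := c.exists_atlas_eq_cotanChart
  have h1 : (e : Cotan n π → _) = c.cotanChart := congrArg PartialEquiv.toFun h
  have h2 : ζ ∈ e.source := by rw [h]; exact hζ
  have : IsManifold 𝓘(ℝ, Base n × Base n) 1 (Cotan n π) := IsManifold.of_le (n := ∞) (by simp)
  unfold dcotan
  exact h1 ▸ bijective_mfderiv_of_mem_atlas he h2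

theorem AdaptedChart.dvdual_bijective (c : AdaptedChart n π) {ξ : VDual n π}
    (hξ : ξ.base ∈ c.e.source) : Function.Bijective (c.dvdual ξ) := by
  obtain ⟨e, he, h⟩ := c.exists_atlas_eq_vdualChart
  have h1 : (e : VDual n π → _) = c.vdualChart := congrArg PartialEquiv.toFun h
  have h2 : ξ ∈ e.source := by rw [h]; exact hξ
  have : IsManifold 𝓘(ℝ, Fiber n) 1 (VDual n π) := IsManifold.of_le (n := ∞) (by simp)
  unfold dvdual
  exact h1 ▸ bijective_mfderiv_of_mem_atlas he h2

/-- In every canonical chart, `Ω = dt ∧ dp_t + dqⁱ ∧ dp_i`. -/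
theorem AdaptedChart.symp_eq_dcotan (c : AdaptedChart n π) {ζ : Cotan n π}
    (hζ : ζ.base ∈ c.e.source) (X Y : TangentSpace 𝓘(ℝ, Base n × Base n) ζ) :
    symp ζ X Y = ofCoeffs (c.dcotan ζ Y).2 (c.dcotan ζ X).1 -
      ofCoeffs (c.dcotan ζ X).2 (c.dcotan ζ Y).1 := by
  set c₀ : AdaptedChart n π := chartAround π ζ.base with hc₀
  set F : Base n × Base n → Base n × Base n := fun z => c.cotanChart (c₀.cotanChart.symm z) with hF
  set z : Base n × Base n := c₀.cotanChart ζ with hz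
  have hζ₀ : ζ.base ∈ c₀.e.source := mem_chartAround _
  have hinv : c₀.cotanChart.symm z = ζ := c₀.cotanChart.left_inv hζ₀
  have hzs : z ∈ (c₀.cotanChart.symm.trans c.cotanChart).source := by
    refine ⟨c₀.cotanChart.map_source hζ₀, ?_⟩
    change (c₀.cotanChart.symm z).base ∈ c.e.source
    rw [hinv]; exact hζ
  have hnhds := (c₀.cotanChart_isOpen c).mem_nhds hzs
  have hcd : ContDiffAt ℝ ∞ F z := (c₀.cotanChart_contDiffOn c).contDiffAt hnhds
  have hD : c.dcotan ζ = (fderiv ℝ F z : Base n × Base n →L[ℝ] Base n × Base n) := by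
    refine HasMFDerivAt.mfderiv (hasMFDerivAt_of_charts (g := F)
      (Filter.Eventually.of_forall fun _ => mem_univ _) ?_
      (hcd.differentiableAt (by simp)).hasFDerivAt)
    filter_upwards [eventually_cotan ζ] with y hy
    exact congrArg c.cotanChart (c₀.cotanChart.left_inv hy).symm
  have key := skew_pullback_of_pullback (stdLiouville n) hcd (by
    filter_upwards [hnhds] with y hy Y using c₀.stdLiouville_trans c hy Y) Y X
  rw [hD]
  exact (symp_eq ζ X Y).trans key.symm

/-- In coordinates, `Tμ` forgets the component of `∂/∂p_t`. -/
theorem AdaptedChart.dvdual_dmu (c : AdaptedChart n π) {ζ : Cotan n π}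
    (hζ : ζ.base ∈ c.e.source) (X : TangentSpace 𝓘(ℝ, Base n × Base n) ζ) :
    c.dvdual (mu ζ) (dmu ζ X) = ((c.dcotan ζ X).1, (c.dcotan ζ X).2.2) := by
  let L : Base n × Base n →L[ℝ] Fiber n :=
    (ContinuousLinearMap.fst ℝ (Base n) (Base n)).prod
      ((ContinuousLinearMap.snd ℝ ℝ (Fin n → ℝ)).comp (ContinuousLinearMap.snd ℝ (Base n) (Base n)))
  have a1 := (c.mdifferentiableAt_vdualChart (ξ := mu ζ) hζ).hasMFDerivAt.comp ζ
    (hasMFDerivAt_mu ζ).mdifferentiableAt.hasMFDerivAt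
  have a2 := L.hasMFDerivAt.comp ζ
    (HamiltonianSection.mdifferentiableAt_cotanChart c hζ).hasMFDerivAt
  have a3 : c.vdualChart ∘ mu =ᶠ[𝓝 ζ] L ∘ c.cotanChart := by
    obtain ⟨e, he, h⟩ := c.exists_atlas_eq_cotanChart
    have h2 : ζ ∈ e.source := by rw [h]; exact hζ
    filter_upwards [e.open_source.mem_nhds h2] with y hy
    rw [h] at hy
    exact vdualChart_mu y c hy
  exact DFunLike.congr_fun (hasMFDerivAt_unique a1 (a2.congr_of_eventuallyEq a3)) X

/-- The image under `Tμ ∘ b_Ω⁻¹` of a covector `β ∘ d(t, qⁱ, p_t, p_i)`, in the coordinates induced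
by an arbitrary adapted chart. -/
theorem AdaptedChart.dvdual_dmu_sympInv (c : AdaptedChart n π) {ζ : Cotan n π}
    (hζ : ζ.base ∈ c.e.source) (β : Base n × Base n →L[ℝ] ℝ) :
    c.dvdual (mu ζ) (dmu ζ (sympInv ζ (β.comp (c.dcotan ζ)))) =
      ((β (0, (1, 0)), fun i => β (0, (0, Pi.single i 1))),
        fun i => -β ((0, Pi.single i 1), 0)) := by
  rw [c.dvdual_dmu hζ]
  refine eq_of_stdSymp_eq fun Y => ?_
  obtain ⟨Y', rfl⟩ := (c.dcotan_bijective hζ).surjective Y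
  rw [← c.symp_eq_dcotan hζ, symp_sympInv]
  rfl

end Transition

/-! ### The Hamiltonian vector field and its integral curves -/

/-- The velocity of the image of a curve under a map into a vector space. -/
theorem hasDerivAt_comp_of_mdifferentiableAt {F H X : Type*} [NormedAddCommGroup F]
    [NormedSpace ℝ F] [TopologicalSpace H] {I : ModelWithCorners ℝ F H} [TopologicalSpace X]
    [ChartedSpace H X] {G : Type*} [NormedAddCommGroup G] [NormedSpace ℝ G] {f : X → G}
    {γ : ℝ → X} {t : ℝ} (hf : MDifferentiableAt I 𝓘(ℝ, G) f (γ t))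
    (hγ : MDifferentiableAt 𝓘(ℝ, ℝ) I γ t) :
    HasDerivAt (fun s => f (γ s))
      (mfderiv I 𝓘(ℝ, G) f (γ t) (mfderiv 𝓘(ℝ, ℝ) I γ t (1 : ℝ)) : G) t :=
  HasFDerivAt.hasDerivAt (f := fun s => f (γ s))
    (hasMFDerivAt_iff_hasFDerivAt.1 (hf.hasMFDerivAt.comp t hγ.hasMFDerivAt))

section Hamiltonian

variable {n : ℕ} {M : Type*} [TopologicalSpace M] [ChartedSpace (Base n) M] {π : M → ℝ}
  [IsManifold 𝓘(ℝ, Base n) ∞ M] [IsFibration n π]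

/-- In every adapted chart, the Poisson structure of `V*π` is `∂/∂qⁱ ∧ ∂/∂p_i`. -/
theorem AdaptedChart.dvdual_poissonV (c : AdaptedChart n π) {ξ : VDual n π}
    (hξ : ξ.base ∈ c.e.source) (α : Fiber n →L[ℝ] ℝ) :
    c.dvdual ξ (poissonV n π ξ (α.comp (c.dvdual ξ))) = stdSharp n α := by
  obtain ⟨ζ, hζ, hP⟩ : ∃ (ζ : Cotan n π) (hζ : mu ζ = ξ), poissonV n π ξ =
      hζ ▸ (-(dmu ζ).comp ((sympInv ζ).comp (ContinuousLinearMap.precomp ℝ (dmu ζ)))) :=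
    ⟨_, _, rfl⟩
  subst hζ
  rw [hP]
  let β : Base n × Base n →L[ℝ] ℝ := α.comp ((ContinuousLinearMap.fst ℝ (Base n) (Base n)).prod
      ((ContinuousLinearMap.snd ℝ ℝ (Fin n → ℝ)).comp
        (ContinuousLinearMap.snd ℝ (Base n) (Base n))))
  have h1 : (α.comp (c.dvdual (mu ζ))).comp (dmu ζ) = β.comp (c.dcotan ζ) :=
    ContinuousLinearMap.ext fun X => congrArg α (c.dvdual_dmu hξ X)
  have h2 := c.dvdual_dmu_sympInv (ζ := ζ) hξ β
  rw [← h1] at h2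
  refine (map_neg (c.dvdual (mu ζ)) _).trans ((congrArg Neg.neg h2).trans ?_)
  rw [stdSharp_apply]
  have h3 : β (0, (1, 0)) = 0 := map_zero α
  refine Prod.ext (Prod.ext ?_ (funext fun i => rfl)) (funext fun i => ?_)
  · exact (congrArg Neg.neg h3).trans neg_zero
  · exact neg_neg _

namespace HamiltonianSection

variable (h : HamiltonianSection n π) (c : AdaptedChart n π)

theorem base_toFun (ξ : VDual n π) : (h.toFun ξ).base = ξ.base :=
  congrArg VDual.base (h.mu_toFun ξ)

theorem isOpen_vdualChart_target : IsOpen c.vdualChart.target :=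
  c.e.open_target.prod isOpen_univ

theorem contDiffOn_localHamiltonian :
    ContDiffOn ℝ ∞ (h.localHamiltonian c) c.vdualChart.target := by
  obtain ⟨e, he, hec⟩ := c.exists_atlas_eq_vdualChart
  obtain ⟨e', he', hec'⟩ := c.exists_atlas_eq_cotanChart
  have h1 : ContMDiffOn 𝓘(ℝ, Fiber n) 𝓘(ℝ, Fiber n) ∞ e.symm e.target :=
    contMDiffOn_symm_of_mem_maximalAtlas (IsManifold.subset_maximalAtlas he)
  have h2 : ContMDiffOn 𝓘(ℝ, Base n × Base n) 𝓘(ℝ, Base n × Base n) ∞ e' e'.source :=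
    contMDiffOn_of_mem_maximalAtlas (IsManifold.subset_maximalAtlas he')
  have h3 := h2.comp ((h.contMDiff.comp_contMDiffOn h1)) (by
    intro z hz
    have hz' : e.symm z ∈ e.source := e.map_target hz
    rw [hec] at hz'
    change h.toFun (e.symm z) ∈ e'.source
    rw [hec']
    change (h.toFun (e.symm z)).base ∈ c.e.source
    rw [h.base_toFun]
    exact hz')
  rw [contMDiffOn_iff_contDiffOn] at h3
  have h4 : (e' ∘ h.toFun ∘ e.symm : Fiber n → Base n × Base n) =
      fun z => c.cotanChart (h.toFun (c.vdualChart.symm z)) := by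
    funext z
    change e'.toPartialEquiv (h.toFun (e.toPartialEquiv.symm z)) = _
    rw [hec, hec']
  have h5 : e.target = c.vdualChart.target := congrArg PartialEquiv.target hec
  have h6 : ContDiffOn ℝ ∞ (fun z => c.cotanChart (h.toFun (c.vdualChart.symm z)))
      c.vdualChart.target := by
    rw [← h4, ← h5]; exact h3
  exact h6.snd.fst.neg

theorem contDiffOn_fderiv_localHamiltonian :
    ContDiffOn ℝ ∞ (fderiv ℝ (h.localHamiltonian c)) c.vdualChart.target :=
  (h.contDiffOn_localHamiltonian c).fderiv_of_isOpen (isOpen_vdualChart_target c) (by simp)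

/-- In coordinates, `F_h = p_t + H(t, q, p)`. -/
theorem potential_eq {ζ : Cotan n π} (hζ : ζ.base ∈ c.e.source) :
    h.potential ζ = (c.cotanChart ζ).2.1 + h.localHamiltonian c (c.vdualChart (mu ζ)) := by
  have h1 := congrArg (fun z => (c.cotanChart z).2.1) (h.eq_translate ζ)
  have h2 : (h.toFun (mu ζ)).base ∈ c.e.source := by rw [h.base_toFun]; exact hζ
  rw [cotanChart_translate _ c h2] at h1
  unfold localHamiltonian
  rw [c.vdualChart.left_inv (show mu ζ ∈ c.vdualChart.source from hζ), h1]
  simp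

/-- In coordinates, `dF_h = dp_t + dH`. -/
theorem dpotential_eq {ζ : Cotan n π} (hζ : ζ.base ∈ c.e.source) :
    h.dpotential ζ = ((ContinuousLinearMap.fst ℝ ℝ (Fin n → ℝ)).comp
        (ContinuousLinearMap.snd ℝ (Base n) (Base n)) +
      (fderiv ℝ (h.localHamiltonian c) (c.vdualChart (mu ζ))).comp
        ((ContinuousLinearMap.fst ℝ (Base n) (Base n)).prod
          ((ContinuousLinearMap.snd ℝ ℝ (Fin n → ℝ)).comp
            (ContinuousLinearMap.snd ℝ (Base n) (Base n))))).comp (c.dcotan ζ) := by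
  have h1 := ((ContinuousLinearMap.fst ℝ ℝ (Fin n → ℝ)).comp
    (ContinuousLinearMap.snd ℝ (Base n) (Base n))).hasMFDerivAt.comp ζ
    (mdifferentiableAt_cotanChart c hζ).hasMFDerivAt
  have hz : c.vdualChart (mu ζ) ∈ c.vdualChart.target := c.vdualChart.map_source hζ
  have hH := (((h.contDiffOn_localHamiltonian c).contDiffAt
    ((isOpen_vdualChart_target c).mem_nhds hz)).differentiableAt (by simp)).hasFDerivAt
  have h2 := hH.hasMFDerivAt.comp ζ ((c.mdifferentiableAt_vdualChart (ξ := mu ζ)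
    hζ).hasMFDerivAt.comp ζ (hasMFDerivAt_mu ζ).mdifferentiableAt.hasMFDerivAt)
  have h3 := h1.add h2
  have h4 : h.potential =ᶠ[𝓝 ζ] fun y => (c.cotanChart y).2.1 +
      h.localHamiltonian c (c.vdualChart (mu y)) := by
    obtain ⟨e, he, hec⟩ := c.exists_atlas_eq_cotanChart
    have hs : ζ ∈ e.source := by rw [hec]; exact hζ
    filter_upwards [e.open_source.mem_nhds hs] with y hy
    rw [hec] at hy
    exact h.potential_eq c hy
  refine (h3.congr_of_eventuallyEq h4).mfderiv.trans (ContinuousLinearMap.ext fun X => ?_)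
  exact congrArg (fun w => (c.dcotan ζ X).2.1 +
    fderiv ℝ (h.localHamiltonian c) (c.vdualChart (mu ζ)) w) (c.dvdual_dmu hζ X)

/-- The Hamiltonian vector field `∂/∂t + (∂H/∂p_i) ∂/∂qⁱ - (∂H/∂qⁱ) ∂/∂p_i` in coordinates. -/
def localField (z : Fiber n) : Fiber n :=
  ((1, fun i => h.partialP c i z), fun i => -h.partialQ c i z)

theorem proj_bPi_symm (ξ : VDual n π) : ((bPi n π).symm (h.dhTilde ξ)).1.proj = ξ :=
  h.mu_toFun ξ

/-- In every adapted chart, `b_π⁻¹ ∘ d̃h` is the Hamiltonian vector field. -/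
theorem dvdual_bPi_symm {ξ : VDual n π} (hξ : ξ.base ∈ c.e.source) :
    c.dvdual _ ((bPi n π).symm (h.dhTilde ξ)).1.2 = h.localField c (c.vdualChart ξ) := by
  have hζ : (h.toFun ξ).base ∈ c.e.source := by rw [h.base_toFun]; exact hξ
  have h1 := c.dvdual_dmu_sympInv hζ ((ContinuousLinearMap.fst ℝ ℝ (Fin n → ℝ)).comp
        (ContinuousLinearMap.snd ℝ (Base n) (Base n)) +
      (fderiv ℝ (h.localHamiltonian c) (c.vdualChart (mu (h.toFun ξ)))).comp
        ((ContinuousLinearMap.fst ℝ (Base n) (Base n)).prod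
          ((ContinuousLinearMap.snd ℝ ℝ (Fin n → ℝ)).comp
            (ContinuousLinearMap.snd ℝ (Base n) (Base n)))))
  rw [← h.dpotential_eq c hζ] at h1
  refine h1.trans ?_
  rw [h.mu_toFun]
  refine Prod.ext (Prod.ext ?_ (funext fun i => ?_)) (funext fun i => ?_)
  · change 1 + fderiv ℝ (h.localHamiltonian c) (c.vdualChart ξ) 0 = 1
    simp
  · exact zero_add _
  · exact congrArg Neg.neg (zero_add _)

/-- In every adapted chart, the component of `∂/∂t` is `dπ₁*`. -/
theorem fst_dvdual {ξ : VDual n π} (hξ : ξ.base ∈ c.e.source)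
    (X : TangentSpace 𝓘(ℝ, Fiber n) ξ) : (c.dvdual ξ X).1.1 = dtime ξ X := by
  let L : Fiber n →L[ℝ] ℝ := (ContinuousLinearMap.fst ℝ ℝ (Fin n → ℝ)).comp
    (ContinuousLinearMap.fst ℝ (Base n) (Fin n → ℝ))
  have h1 := L.hasMFDerivAt.comp ξ (c.mdifferentiableAt_vdualChart hξ).hasMFDerivAt
  have h2 : time =ᶠ[𝓝 ξ] L ∘ c.vdualChart := by
    obtain ⟨e, he, hec⟩ := c.exists_atlas_eq_vdualChart
    have hs : ξ ∈ e.source := by rw [hec]; exact hξ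
    filter_upwards [e.open_source.mem_nhds hs] with y hy
    rw [hec] at hy
    exact (c.fst_eq _ hy).symm
  exact (DFunLike.congr_fun (h1.congr_of_eventuallyEq h2).mfderiv X).symm

/-- The set `S_h` is the image of the Hamiltonian vector field, in every adapted chart. -/
theorem mem_lagr_iff {v : TangentBundle 𝓘(ℝ, Fiber n) (VDual n π)}
    (hv : v.proj.base ∈ c.e.source) :
    v ∈ h.lagr ↔ c.dvdual v.proj v.2 = h.localField c (c.vdualChart v.proj) := by
  constructor
  · rintro ⟨_, ⟨_, ⟨ξ, rfl⟩, rfl⟩, rfl⟩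
    rw [h.proj_bPi_symm] at hv
    refine (h.dvdual_bPi_symm c hv).trans ?_
    rw [h.proj_bPi_symm]
  · intro hv2
    refine ⟨(bPi n π).symm (h.dhTilde v.proj), ⟨_, ⟨v.proj, rfl⟩, rfl⟩, ?_⟩
    have h1 := h.dvdual_bPi_symm c hv
    have h2 := h.proj_bPi_symm v.proj
    generalize ((bPi n π).symm (h.dhTilde v.proj)).1 = w at h1 h2
    obtain ⟨ξ, X⟩ := v
    obtain ⟨ξ', Y⟩ := w
    obtain rfl : ξ' = ξ := h2
    congr 1
    exact (c.dvdual_bijective hv).injective (h1.trans hv2.symm)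

theorem residual_eq_zero_iff {v : TangentBundle 𝓘(ℝ, Fiber n) (VDual n π)}
    (hv : v.proj.base ∈ c.e.source) (hJ : v ∈ jetSet n π) :
    h.residual c v = 0 ↔ v ∈ h.lagr := by
  rw [h.mem_lagr_iff c hv]
  have h1 : (c.dvdual v.proj v.2).1.1 = 1 := (fst_dvdual c hv v.2).trans hJ
  have h2 : h.residual c v = (fun i => (c.dvdual v.proj v.2).1.2 i - h.partialP c i
    (c.vdualChart v.proj), fun i => (c.dvdual v.proj v.2).2 i +
      h.partialQ c i (c.vdualChart v.proj)) := rfl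
  rw [h2]
  simp only [localField, Prod.ext_iff, funext_iff, h1, true_and, Prod.fst_zero, Prod.snd_zero,
    Pi.zero_apply, sub_eq_zero, add_eq_zero_iff_eq_neg]

theorem lagr_subset_jetSet : h.lagr ⊆ jetSet n π := by
  rintro _ ⟨w, _, rfl⟩
  exact w.2

/-- The vanishing of the residual at `j¹τ(t)` is, in one adapted chart, equivalent to `j¹τ(t) ∈ S_h`,
and in all adapted charts to the Hamilton equations: the solutions are the integral curves of
`b_π⁻¹ ∘ d̃h`. -/
theorem isSolution_iff {U : Set ℝ} {τ : ℝ → VDual n π} (hU : IsOpen U)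
    (hτ : ContMDiffOn 𝓘(ℝ, ℝ) 𝓘(ℝ, Fiber n) ∞ τ U) (ht : ∀ t ∈ U, time (τ t) = t) :
    h.IsSolution τ U ↔ ∀ t ∈ U, ((bPi n π).symm (h.dhTilde (τ t))).1 = jetProlong τ t := by
  have hd : ∀ t ∈ U, MDifferentiableAt 𝓘(ℝ, ℝ) 𝓘(ℝ, Fiber n) τ t := fun t ht' =>
    (hτ.contMDiffAt (hU.mem_nhds ht')).mdifferentiableAt (by simp)
  have hjet : ∀ t ∈ U, jetProlong τ t ∈ jetSet n π := by
    intro t ht'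
    have h1 := ((hasMFDerivAt_time (τ t)).mdifferentiableAt.hasMFDerivAt).comp t
      (hd t ht').hasMFDerivAt
    have h2 : time ∘ τ =ᶠ[𝓝 t] id := by
      filter_upwards [hU.mem_nhds ht'] with s hs using ht s hs
    have h3 : HasMFDerivAt 𝓘(ℝ, ℝ) 𝓘(ℝ, ℝ) (time ∘ τ) t (ContinuousLinearMap.id ℝ ℝ) :=
      (hasMFDerivAt_id t).congr_of_eventuallyEq h2
    exact DFunLike.congr_fun (hasMFDerivAt_unique h1 h3) (1 : ℝ)
  have hcoord : ∀ (c : AdaptedChart n π), ∀ t ∈ U, (τ t).base ∈ c.e.source →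
      HasDerivAt (fun s => c.vdualChart (τ s)) (c.dvdual (τ t) (jetProlong τ t).2) t := by
    intro c t ht' hc
    exact hasDerivAt_comp_of_mdifferentiableAt (c.mdifferentiableAt_vdualChart hc) (hd t ht')
  have hlagr : ∀ t, ((bPi n π).symm (h.dhTilde (τ t))).1 = jetProlong τ t ↔
      jetProlong τ t ∈ h.lagr := by
    intro t
    constructor
    · intro h1
      exact ⟨_, ⟨_, ⟨τ t, rfl⟩, rfl⟩, h1⟩
    · rintro ⟨_, ⟨_, ⟨ξ, rfl⟩, rfl⟩, h1⟩
      have h2 : ξ = τ t := (h.proj_bPi_symm ξ).symm.trans (congrArg Bundle.TotalSpace.proj h1)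
      rw [← h2]; exact h1
  constructor
  · intro hsol t ht'
    set c : AdaptedChart n π := chartAround π (τ t).base
    have hc : (τ t).base ∈ c.e.source := mem_chartAround _
    rw [hlagr, ← h.residual_eq_zero_iff c hc (hjet t ht')]
    have h1 := hcoord c t ht' hc
    have h1a := hasDerivAt_pi.1 (((ContinuousLinearMap.snd ℝ ℝ (Fin n → ℝ)).comp
      (ContinuousLinearMap.fst ℝ (Base n) (Fin n → ℝ))).hasFDerivAt.comp_hasDerivAt t h1)
    have h1b := hasDerivAt_pi.1 ((ContinuousLinearMap.snd ℝ (Base n)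
      (Fin n → ℝ)).hasFDerivAt.comp_hasDerivAt t h1)
    refine Prod.ext (funext fun i => sub_eq_zero.2 ?_)
      (funext fun i => add_eq_zero_iff_eq_neg.2 ?_)
    · exact (h1a i).unique (hsol c t ht' hc i).1
    · exact (h1b i).unique (hsol c t ht' hc i).2
  · intro hall c t ht' hc i
    have h2 := (h.residual_eq_zero_iff c hc (hjet t ht')).2 ((hlagr t).1 (hall t ht'))
    have h1 := hcoord c t ht' hc
    have h1a := hasDerivAt_pi.1 (((ContinuousLinearMap.snd ℝ ℝ (Fin n → ℝ)).comp
      (ContinuousLinearMap.fst ℝ (Base n) (Fin n → ℝ))).hasFDerivAt.comp_hasDerivAt t h1)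
    have h1b := hasDerivAt_pi.1 ((ContinuousLinearMap.snd ℝ (Base n)
      (Fin n → ℝ)).hasFDerivAt.comp_hasDerivAt t h1)
    have h3 := sub_eq_zero.1 (congrFun (congrArg Prod.fst h2) i)
    have h4 := add_eq_zero_iff_eq_neg.1 (congrFun (congrArg Prod.snd h2) i)
    refine ⟨?_, ?_⟩
    · rw [← show _ = h.partialP c i (c.vdualChart (τ t)) from h3]; exact h1a i
    · rw [← show _ = -h.partialQ c i (c.vdualChart (τ t)) from h4]; exact h1b i

end HamiltonianSection

end Hamiltonian

/-! ### Tangent vectors of subsets of a tangent bundle -/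

section TangentBundleCharts

variable {E : Type*} [NormedAddCommGroup E] [NormedSpace ℝ E] {N : Type*} [TopologicalSpace N]
  [ChartedSpace E N] [IsManifold 𝓘(ℝ, E) 1 N]

/-- The coordinates `(x, ẋ)` of `TN` in the chart at `v`. -/
def tangentCoord (v w : TangentBundle 𝓘(ℝ, E) N) : E × E := chartAt (ModelProd E E) v w

/-- The chart `(x, ẋ)` of `TN` induced by a chart of `N` is the tangent map of that chart. -/
theorem tangentCoord_apply (v w : TangentBundle 𝓘(ℝ, E) N)
    (hw : w.proj ∈ (chartAt E v.proj).source) :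
    tangentCoord v w = (chartAt E v.proj w.proj,
      (mfderiv 𝓘(ℝ, E) 𝓘(ℝ, E) (chartAt E v.proj) w.proj w.2 : E)) := by
  have hd : MDifferentiableAt 𝓘(ℝ, E) 𝓘(ℝ, E) (chartAt E v.proj) w.proj :=
    mdifferentiableAt_atlas (chart_mem_atlas E v.proj) hw
  exact Prod.ext rfl (congrArg (fun A : E →L[ℝ] E => A w.2) (if_pos hd).symm)

/-- On the fibre over its base point, the chart of `TN` at `v` is the identity. -/
theorem tangentCoord_mk_self (v : TangentBundle 𝓘(ℝ, E) N) (X : E) :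
    tangentCoord v (⟨v.proj, X⟩ : TangentBundle 𝓘(ℝ, E) N) =
      (chartAt E v.proj v.proj, X) := by
  have h : mfderiv 𝓘(ℝ, E) 𝓘(ℝ, E) (chartAt E v.proj) v.proj = ContinuousLinearMap.id ℝ E :=
    mfderiv_extChartAt_self (I := 𝓘(ℝ, E)) (x := v.proj)
  refine (tangentCoord_apply v ⟨v.proj, X⟩ (mem_chart_source E v.proj)).trans ?_
  exact Prod.ext rfl (DFunLike.congr_fun h X)

/-- The velocity of a curve in `TN` is the derivative of its coordinates. -/
theorem hasDerivAt_tangentCoord {γ : ℝ → TangentBundle 𝓘(ℝ, E) N}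
    (hγ : MDifferentiableAt 𝓘(ℝ, ℝ) 𝓘(ℝ, E).tangent γ 0) :
    HasDerivAt (fun s => tangentCoord (γ 0) (γ s))
      (mfderiv 𝓘(ℝ, ℝ) 𝓘(ℝ, E).tangent γ 0 (1 : ℝ) : E × E) 0 := by
  obtain ⟨D, hD⟩ : ∃ D : ℝ →L[ℝ] E × E, D = mfderiv 𝓘(ℝ, ℝ) 𝓘(ℝ, E).tangent γ 0 := ⟨_, rfl⟩
  have h : HasFDerivWithinAt (fun s => tangentCoord (γ 0) (γ s)) D (range (id : ℝ → ℝ)) 0 := by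
    rw [hD]
    exact hγ.hasMFDerivAt.2
  rw [range_id, hasFDerivWithinAt_univ] at h
  rw [← hD]
  exact h.hasDerivAt

/-- A curve with differentiable coordinates is differentiable, with the expected velocity. -/
theorem mfderiv_eq_of_tangentCoord_eq {γ : ℝ → TangentBundle 𝓘(ℝ, E) N} {g : ℝ → E × E}
    {w : E × E}
    (h1 : ∀ᶠ s in 𝓝 0, γ s ∈ (chartAt (ModelProd E E) (γ 0)).source)
    (h2 : ∀ᶠ s in 𝓝 0, tangentCoord (γ 0) (γ s) = g s)
    (hg : HasDerivAt g w 0) :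
    MDifferentiableAt 𝓘(ℝ, ℝ) 𝓘(ℝ, E).tangent γ 0 ∧
      mfderiv 𝓘(ℝ, ℝ) 𝓘(ℝ, E).tangent γ 0 (1 : ℝ) = (w : E × E) := by
  have hg0 : g 0 = tangentCoord (γ 0) (γ 0) := h2.self_of_nhds.symm
  have hc : ContinuousAt γ 0 := by
    have h3 : ContinuousAt (fun s => (chartAt (ModelProd E E) (γ 0)).symm (g s)) 0 := by
      refine ContinuousAt.comp (g := (chartAt (ModelProd E E) (γ 0)).symm) ?_ hg.continuousAt
      refine (chartAt (ModelProd E E) (γ 0)).continuousAt_symm ?_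
      rw [hg0]
      exact mem_chart_target (ModelProd E E) (γ 0)
    refine h3.congr ?_
    filter_upwards [h1, h2] with s hs1 hs2
    rw [← hs2]
    exact (chartAt (ModelProd E E) (γ 0)).left_inv hs1
  have hd : HasMFDerivAt 𝓘(ℝ, ℝ) 𝓘(ℝ, E).tangent γ 0
      (ContinuousLinearMap.toSpanSingleton ℝ w) := by
    refine ⟨hc, ?_⟩
    have h4 : (fun s => tangentCoord (γ 0) (γ s)) =ᶠ[𝓝 0] g := h2
    have h5 : HasFDerivWithinAt (fun s => tangentCoord (γ 0) (γ s))
        (ContinuousLinearMap.toSpanSingleton ℝ w) (range (id : ℝ → ℝ)) 0 :=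
      (hg.congr_of_eventuallyEq h4).hasFDerivAt.hasFDerivWithinAt
    exact h5
  refine ⟨hd.mdifferentiableAt, ?_⟩
  rw [hd.mfderiv]
  exact one_smul ℝ w

/-- The tangent space of a set which, in a chart, is contained in the zeros of `φ` is contained in
the kernel of the differential of `φ`. -/
theorem fderiv_eq_zero_of_mem_tangentTo {G : Type*} [NormedAddCommGroup G] [NormedSpace ℝ G]
    {C : Set (TangentBundle 𝓘(ℝ, E) N)} {v : TangentBundle 𝓘(ℝ, E) N} {φ : E × E → G}
    {φ' : E × E →L[ℝ] G} (hφ : HasFDerivAt φ φ' (tangentCoord v v))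
    (hC : ∀ y ∈ C, y ∈ (chartAt (ModelProd E E) v).source →
      φ (tangentCoord v y) = 0)
    {w : E × E} (hw : w ∈ tangentTo 𝓘(ℝ, E).tangent C v) : φ' w = 0 := by
  refine Submodule.span_induction (p := fun x _ => φ' (x : E × E) = 0) ?_ (map_zero φ')
    (fun x y _ _ hx hy => (map_add φ' x y).trans (by rw [hx, hy, add_zero]))
    (fun a x _ hx => (map_smul φ' a x).trans (by rw [hx, smul_zero])) hw
  rintro x ⟨γ, rfl, hγC, hγd, hγ⟩
  have h1 := HasFDerivAt.comp_hasDerivAt (f := fun s => tangentCoord (γ 0) (γ s)) (0 : ℝ) hφ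
    (hasDerivAt_tangentCoord hγd)
  have h2 : (φ ∘ fun s => tangentCoord (γ 0) (γ s)) =ᶠ[𝓝 0] fun _ => 0 := by
    filter_upwards [hγC, hγd.continuousAt (chart_source_mem_nhds (ModelProd E E) (γ 0))]
      with s hs1 hs2 using hC _ hs1 hs2
  rw [← hγ]
  exact h1.unique ((hasDerivAt_const (0 : ℝ) (0 : G)).congr_of_eventuallyEq h2)

/-- The velocity of a curve given in a chart is tangent to any set containing the curve. -/
theorem mem_tangentTo_of_chart {C : Set (TangentBundle 𝓘(ℝ, E) N)} {v : TangentBundle 𝓘(ℝ, E) N}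
    {g : ℝ → E × E} {w : E × E} (hg0 : g 0 = tangentCoord v v) (hg : HasDerivAt g w 0)
    (hC : ∀ᶠ s in 𝓝 0, ∀ y ∈ (chartAt (ModelProd E E) v).source,
      tangentCoord v y = g s → y ∈ C) :
    w ∈ tangentTo 𝓘(ℝ, E).tangent C v := by
  set e := chartAt (ModelProd E E) v with he
  have h0 : e.symm (g 0) = v := by rw [hg0]; exact e.left_inv (mem_chart_source _ v)
  have ht : ∀ᶠ s in 𝓝 0, g s ∈ e.target := by
    refine hg.continuousAt (e.open_target.mem_nhds ?_)
    rw [hg0]; exact mem_chart_target _ v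
  have h1 := mfderiv_eq_of_tangentCoord_eq (γ := fun s => e.symm (g s)) (g := g) (w := w)
    (by
      rw [h0]
      filter_upwards [ht] with s hs using e.map_target hs)
    (by
      rw [h0]
      filter_upwards [ht] with s hs using e.right_inv hs) hg
  refine Submodule.subset_span ⟨fun s => e.symm (g s), h0, ?_, h1.1, h1.2⟩
  filter_upwards [ht, hC] with s hs1 hs2 using hs2 _ (e.map_target hs1) (e.right_inv hs1)

end TangentBundleCharts

/-! ### The Poisson structure of `J¹π₁*` -/

section JetTangent

variable {n : ℕ} {M : Type*} [TopologicalSpace M] [ChartedSpace (Base n) M] {π : M → ℝ}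
  [IsManifold 𝓘(ℝ, Base n) ∞ M] [IsFibration n π]

theorem tangentCoord_vdual (v w : TangentBundle 𝓘(ℝ, Fiber n) (VDual n π))
    (hw : w.proj.base ∈ (chartAround π v.proj.base : AdaptedChart n π).e.source) :
    tangentCoord v w =
      ((chartAround π v.proj.base : AdaptedChart n π).vdualChart w.proj,
        (chartAround π v.proj.base : AdaptedChart n π).dvdual w.proj w.2) :=
  tangentCoord_apply v w hw

theorem mem_chartAt_tangent_source {v w : TangentBundle 𝓘(ℝ, Fiber n) (VDual n π)} :
    w ∈ (chartAt (ModelProd (Fiber n) (Fiber n)) v).source ↔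
      w.proj.base ∈ (chartAround π v.proj.base : AdaptedChart n π).e.source :=
  TangentBundle.mem_chart_source_iff _ _

/-- The tangent space of `J¹π₁*` is the kernel of `dṫ`. -/
theorem mem_tangentTo_jetSet {v : TangentBundle 𝓘(ℝ, Fiber n) (VDual n π)}
    (hv : v ∈ jetSet n π) (w : Fiber n × Fiber n) :
    w ∈ tangentTo 𝓘(ℝ, Fiber n).tangent (jetSet n π) v ↔ w.2.1.1 = 0 := by
  set c : AdaptedChart n π := chartAround π v.proj.base with hc
  have hvs : v.proj.base ∈ c.e.source := mem_chartAround _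
  let L : Fiber n × Fiber n →L[ℝ] ℝ :=
    ((ContinuousLinearMap.fst ℝ ℝ (Fin n → ℝ)).comp
      (ContinuousLinearMap.fst ℝ (Base n) (Fin n → ℝ))).comp (ContinuousLinearMap.snd ℝ _ _)
  have key : ∀ y : TangentBundle 𝓘(ℝ, Fiber n) (VDual n π),
      y ∈ (chartAt (ModelProd (Fiber n) (Fiber n)) v).source →
      (L (tangentCoord v y) = 1 ↔
        y ∈ jetSet n π) := by
    intro y hy
    have hy' := mem_chartAt_tangent_source.1 hy
    have h1 := congrArg L (tangentCoord_vdual v y hy')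
    rw [h1]
    have h2 := HamiltonianSection.fst_dvdual c hy' y.2
    exact ⟨fun h => h2.symm.trans h, fun h => h2.trans h⟩
  constructor
  · intro hw
    exact fderiv_eq_zero_of_mem_tangentTo (φ := fun z => L z - 1) (L.hasFDerivAt.sub_const 1)
      (fun y hy hys => sub_eq_zero.2 ((key y hys).2 hy)) hw
  · intro hw
    refine mem_tangentTo_of_chart (g := fun s => tangentCoord v v + s • w) ?_ ?_ ?_
    · exact (congrArg (_ + ·) (zero_smul ℝ w)).trans (add_zero _)
    · simpa using (((hasDerivAt_id (0 : ℝ)).smul_const w).const_add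
        (tangentCoord v v))
    · refine Filter.Eventually.of_forall fun s y hy hys => (key y hy).1 ?_
      have h1 : L w = 0 := hw
      refine (congrArg L hys).trans ((map_add L _ _).trans ?_)
      rw [map_smul, h1, smul_zero, add_zero]
      exact (key v (mem_chart_source _ v)).2 hv

/-- The Poisson structure of `V*π` has constant coefficients in the charts of `V*π`. -/
theorem poissonV_inChart (ξ : VDual n π) {y : Fiber n}
    (hy : y ∈ (chartAt (Fiber n) ξ).target) :
    (poissonV n π).inChart ξ y = stdSharp n := by
  refine ContinuousLinearMap.ext fun α => ?_
  have hs : (chartAt (Fiber n) ξ).symm y ∈ (chartAt (Fiber n) ξ).source :=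
    (chartAt (Fiber n) ξ).map_target hy
  exact (chartAround π ξ.base : AdaptedChart n π).dvdual_poissonV hs α

/-- As the coefficients of `∂/∂qⁱ ∧ ∂/∂p_i` are constant, its complete lift maps `a dx + b dẋ` to
`(Λ♯ b, Λ♯ a)`. -/
theorem completeLift_poissonV (v : TangentBundle 𝓘(ℝ, Fiber n) (VDual n π))
    (α : Fiber n × Fiber n →L[ℝ] ℝ) :
    (poissonV n π).completeLift v α =
      (stdSharp n (α.comp (ContinuousLinearMap.inr ℝ _ _)),
        stdSharp n (α.comp (ContinuousLinearMap.inl ℝ _ _))) := by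
  have ht := mem_chart_target (Fiber n) v.proj
  have h1 : (poissonV n π).inChart v.proj =ᶠ[𝓝 (chartAt (Fiber n) v.proj v.proj)]
      fun _ => stdSharp n := by
    filter_upwards [(chartAt (Fiber n) v.proj).open_target.mem_nhds ht] with y hy
    exact poissonV_inChart v.proj hy
  have h2 := h1.self_of_nhds
  have h3 : fderiv ℝ ((poissonV n π).inChart v.proj)
      (chartAt (Fiber n) v.proj v.proj) = 0 := by
    rw [h1.fderiv_eq]; simp
  have h4 : (poissonV n π).completeLift v α =
      ((poissonV n π).inChart v.proj (chartAt (Fiber n) v.proj v.proj)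
          (α.comp (ContinuousLinearMap.inr ℝ _ _)),
        (poissonV n π).inChart v.proj (chartAt (Fiber n) v.proj v.proj)
          (α.comp (ContinuousLinearMap.inl ℝ _ _)) +
        (fderiv ℝ ((poissonV n π).inChart v.proj) (chartAt (Fiber n) v.proj v.proj) :
          Fiber n →L[ℝ] (Fiber n →L[ℝ] ℝ) →L[ℝ] Fiber n) v.2
            (α.comp (ContinuousLinearMap.inr ℝ _ _))) := rfl
  refine h4.trans ?_
  refine Prod.ext (DFunLike.congr_fun h2 _) ?_
  refine (congrArg₂ (· + ·) (DFunLike.congr_fun h2 _)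
    (congrArg (fun A : Fiber n →L[ℝ] (Fiber n →L[ℝ] ℝ) →L[ℝ] Fiber n => A v.2 _) h3)).trans ?_
  exact add_zero _

variable (n π) in
/-- The tangent space of `J¹π₁*`, in the coordinates of the chart at the base point. -/
def jetTangent (v : TangentBundle 𝓘(ℝ, Fiber n) (VDual n π)) : Submodule ℝ (Fiber n × Fiber n) :=
  tangentTo 𝓘(ℝ, Fiber n).tangent (jetSet n π) v

/-- The Poisson structure of `J¹π₁*`, in terms of an extension `α ∘ r` of the covector `α`. The
values of the complete lift are already tangent to `J¹π₁*`, so `r` does not change them. -/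
theorem exists_poissonJet_eq {v : TangentBundle 𝓘(ℝ, Fiber n) (VDual n π)}
    (hv : v ∈ jetSet n π) :
    ∃ r : Fiber n × Fiber n →ₗ[ℝ] jetTangent n π v, (∀ w : jetTangent n π v, r w.1 = w) ∧
      ∀ α : Module.Dual ℝ (jetTangent n π v),
        ((show Module.Dual ℝ (jetTangent n π v) →ₗ[ℝ] jetTangent n π v from
          poissonJet n π v) α).1 =
        (stdSharp n ((LinearMap.toContinuousLinearMap (α ∘ₗ r)).comp
            (ContinuousLinearMap.inr ℝ _ _)),
          stdSharp n ((LinearMap.toContinuousLinearMap (α ∘ₗ r)).comp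
            (ContinuousLinearMap.inl ℝ _ _))) := by
  let hex := LinearMap.exists_leftInverse_of_injective (jetTangent n π v).subtype
    (jetTangent n π v).ker_subtype
  let r : Fiber n × Fiber n →ₗ[ℝ] jetTangent n π v := hex.choose
  have hr : ∀ w : jetTangent n π v, r w.1 = w := fun w => DFunLike.congr_fun hex.choose_spec w
  refine ⟨r, hr, fun α => ?_⟩
  have h2 := completeLift_poissonV v (LinearMap.toContinuousLinearMap (α ∘ₗ r))
  refine congrArg Subtype.val ((congrArg r h2).trans (hr ⟨_, (mem_tangentTo_jetSet hv _).2 rfl⟩))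

end JetTangent

/-! ### Graphs of symmetric forms are Lagrangian -/

section LinearAlgebra

variable {n : ℕ}

/-- `Λ(α, β) = -Λ(β, α)`. -/
theorem stdSharp_skew (α β : Fiber n →L[ℝ] ℝ) : β (stdSharp n α) = -α (stdSharp n β) := by
  have key : ∀ α β : Fiber n →L[ℝ] ℝ, β (stdSharp n α) =
      ∑ i, (α ((0, Pi.single i 1), 0) * β ((0, 0), Pi.single i 1) -
        α ((0, 0), Pi.single i 1) * β ((0, Pi.single i 1), 0)) := by
    intro α β
    have h1 : stdSharp n α = ∑ i, (α ((0, Pi.single i 1), 0) •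
        (((0, 0), Pi.single i 1) : Fiber n) -
        α ((0, 0), Pi.single i 1) • (((0, Pi.single i 1), 0) : Fiber n)) := by
      rw [stdSharp_apply]
      refine Prod.ext (Prod.ext ?_ (funext fun j => ?_)) (funext fun j => ?_)
      · simp [Prod.fst_sum]
      · simp [Prod.fst_sum, Prod.snd_sum, Finset.sum_apply, Pi.single_apply]
      · simp [Prod.snd_sum, Finset.sum_apply, Pi.single_apply]
    rw [h1, map_sum]
    simp only [map_sub, map_smul, smul_eq_mul]
  rw [key, key, ← Finset.sum_neg_distrib]
  exact Finset.sum_congr rfl fun i _ => by ring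

/-- The vertical vectors in coordinates, that is, those with `dt = 0`. -/
def verticalFiber (n : ℕ) : Submodule ℝ (Fiber n) :=
  LinearMap.ker ((LinearMap.fst ℝ ℝ (Fin n → ℝ)).comp (LinearMap.fst ℝ (Base n) (Fin n → ℝ)))

/-- The image of `Λ♯` consists of the vertical vectors. -/
theorem exists_stdSharp_eq {w : Fiber n} (hw : w.1.1 = 0) : ∃ α, stdSharp n α = w := by
  refine ⟨∑ i, (w.2 i • (ContinuousLinearMap.proj i).comp
    ((ContinuousLinearMap.snd ℝ ℝ (Fin n → ℝ)).comp
      (ContinuousLinearMap.fst ℝ (Base n) (Fin n → ℝ))) -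
    w.1.2 i • (ContinuousLinearMap.proj i).comp
      (ContinuousLinearMap.snd ℝ (Base n) (Fin n → ℝ))), ?_⟩
  rw [stdSharp_apply]
  refine Prod.ext (Prod.ext hw.symm (funext fun j => ?_)) (funext fun j => ?_)
  · simp [Pi.single_apply]
  · simp [Pi.single_apply]

/-- `Λ♯` depends only on the restriction of covectors to vertical vectors. -/
theorem stdSharp_congr {α β : Fiber n →L[ℝ] ℝ} (h : ∀ w : Fiber n, w.1.1 = 0 → α w = β w) :
    stdSharp n α = stdSharp n β := by
  rw [stdSharp_apply, stdSharp_apply]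
  refine Prod.ext (Prod.ext rfl (funext fun j => ?_)) (funext fun j => ?_)
  · exact congrArg Neg.neg (h _ rfl)
  · exact h _ rfl

/-- The linear model of the theorem. Let `T` be the hyperplane `dṫ = 0` with the 2-vector
`(a, b) ↦ (Λ♯ b, Λ♯ a)` and let `B` be a symmetric form (the Hessian of the Hamiltonian). Then the
graph of `-Λ♯ ∘ B` is a Lagrangian subspace of `T`. -/
theorem isLagrangianSubspace_graph {T : Submodule ℝ (Fiber n × Fiber n)}
    (hT : ∀ w : Fiber n × Fiber n, w ∈ T ↔ w.2.1.1 = 0) {S : Module.Dual ℝ T →ₗ[ℝ] T}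
    {r : Fiber n × Fiber n →ₗ[ℝ] T} (hr : ∀ w : T, r w.1 = w)
    (hS : ∀ α : Module.Dual ℝ T, (S α).1 =
      (stdSharp n ((LinearMap.toContinuousLinearMap (α ∘ₗ r)).comp
          (ContinuousLinearMap.inr ℝ _ _)),
        stdSharp n ((LinearMap.toContinuousLinearMap (α ∘ₗ r)).comp
          (ContinuousLinearMap.inl ℝ _ _))))
    {B : Fiber n →L[ℝ] Fiber n →L[ℝ] ℝ} (hB : ∀ x y, B x y = B y x) {L : Submodule ℝ T}
    (hL : ∀ w : T, w ∈ L ↔ w.1.2 = -stdSharp n (B w.1.1)) : IsLagrangianSubspace S L := by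
  constructor
  · intro α β hα hβ
    rw [hL] at hα hβ
    have h1 : β (S α) = (LinearMap.toContinuousLinearMap (β ∘ₗ r)) (S α).1 :=
      congrArg β (hr (S α)).symm
    rw [hS] at hα hβ h1
    dsimp only at hα hβ
    set f := LinearMap.toContinuousLinearMap (α ∘ₗ r)
    set g := LinearMap.toContinuousLinearMap (β ∘ₗ r)
    set a := f.comp (ContinuousLinearMap.inl ℝ (Fiber n) (Fiber n))
    set b := f.comp (ContinuousLinearMap.inr ℝ (Fiber n) (Fiber n))
    set a' := g.comp (ContinuousLinearMap.inl ℝ (Fiber n) (Fiber n)) with ha'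
    set b' := g.comp (ContinuousLinearMap.inr ℝ (Fiber n) (Fiber n)) with hb'
    have h2 : g (stdSharp n b, stdSharp n a) = a' (stdSharp n b) + b' (stdSharp n a) := by
      simp [ha', hb', ← map_add]
    rw [h1, h2, stdSharp_skew b a', hα, hβ, map_neg, map_neg, stdSharp_skew _ b,
      stdSharp_skew _ b', hB]
    ring
  -- The image of `S` is `V × V` for the space `V` of vertical vectors, and its intersection with `L`
  -- is the graph of a map `V → V`.
  · let A : Fiber n →ₗ[ℝ] Fiber n := -((stdSharp n).comp B).toLinearMap
    let F : verticalFiber n × verticalFiber n →ₗ[ℝ] T := LinearMap.codRestrict T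
      ((verticalFiber n).subtype.prodMap (verticalFiber n).subtype) fun w => (hT _).2 w.2.2
    let G : verticalFiber n →ₗ[ℝ] T := LinearMap.codRestrict T
      ((verticalFiber n).subtype.prod (A ∘ₗ (verticalFiber n).subtype)) fun w =>
        (hT _).2 neg_zero
    have hF : Function.Injective F := fun x y hxy => by
      have h1 := congrArg Subtype.val hxy
      exact Prod.ext (Subtype.ext (congrArg Prod.fst h1)) (Subtype.ext (congrArg Prod.snd h1))
    have hG : Function.Injective G := fun x y hxy =>
      Subtype.ext (congrArg (fun w : T => w.1.1) hxy)
    have hrange : ∀ w : T, w ∈ LinearMap.range S ↔ w.1.1.1.1 = 0 := by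
      intro w
      constructor
      · rintro ⟨α, rfl⟩
        rw [hS]
        rfl
      · intro hw
        obtain ⟨b, hb⟩ := exists_stdSharp_eq hw
        obtain ⟨a, ha⟩ := exists_stdSharp_eq ((hT _).1 w.2)
        -- The 2-vector exchanges base and fibre components, hence the order of `a` and `b`.
        let α : Module.Dual ℝ T := (a.toLinearMap ∘ₗ LinearMap.fst ℝ (Fiber n) (Fiber n) +
          b.toLinearMap ∘ₗ LinearMap.snd ℝ (Fiber n) (Fiber n)) ∘ₗ T.subtype
        have hα : ∀ u ∈ T, α (r u) = a u.1 + b u.2 := by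
          intro u hu
          rw [hr ⟨u, hu⟩]
          rfl
        refine ⟨α, Subtype.ext ((hS α).trans (Prod.ext (Eq.trans ?_ hb) (Eq.trans ?_ ha)))⟩
        · refine stdSharp_congr fun u hu => ?_
          refine (hα (0, u) ((hT _).2 hu)).trans ?_
          simp
        · refine stdSharp_congr fun u hu => ?_
          refine (hα (u, 0) ((hT _).2 rfl)).trans ?_
          simp
    have hFr : LinearMap.range F = LinearMap.range S := by
      ext w
      rw [hrange]
      constructor
      · rintro ⟨x, rfl⟩
        exact x.1.2
      · intro hw
        exact ⟨(⟨w.1.1, hw⟩, ⟨w.1.2, (hT _).1 w.2⟩), rfl⟩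
    have hGr : LinearMap.range G = L ⊓ LinearMap.range S := by
      ext w
      rw [Submodule.mem_inf, hrange, hL]
      constructor
      · rintro ⟨x, rfl⟩
        exact ⟨rfl, x.2⟩
      · rintro ⟨hw1, hw2⟩
        exact ⟨⟨w.1.1, hw2⟩, Subtype.ext (Prod.ext rfl hw1.symm)⟩
    rw [← hGr, ← hFr, LinearMap.finrank_range_of_inj hF, LinearMap.finrank_range_of_inj hG,
      Module.finrank_prod, two_mul]

end LinearAlgebra

/-! ### The Lagrangian submanifold `S_h` -/

section Lagrangian

variable {n : ℕ} {M : Type*} [TopologicalSpace M] [ChartedSpace (Base n) M] {π : M → ℝ}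
  [IsManifold 𝓘(ℝ, Base n) ∞ M] [IsFibration n π]

namespace HamiltonianSection

variable (h : HamiltonianSection n π) (c : AdaptedChart n π)

/-- The Hamiltonian vector field is `∂/∂t - Λ♯(dH)`. -/
theorem localField_eq (z : Fiber n) :
    h.localField c z = ((1, 0), 0) - stdSharp n (fderiv ℝ (h.localHamiltonian c) z) := by
  rw [stdSharp_apply]
  refine Prod.ext (Prod.ext ?_ (funext fun j => ?_)) (funext fun j => ?_)
  · simp [localField]
  · simp [localField, partialP]
  · simp [localField, partialQ]

theorem contDiffOn_localField : ContDiffOn ℝ ∞ (h.localField c) c.vdualChart.target := by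
  have h1 : h.localField c = fun z => ((1, 0), 0) - stdSharp n (fderiv ℝ (h.localHamiltonian c) z) :=
    funext (h.localField_eq c)
  rw [h1]
  exact contDiffOn_const.sub
    ((stdSharp n).contDiff.comp_contDiffOn (h.contDiffOn_fderiv_localHamiltonian c))

theorem hasFDerivAt_localField {z : Fiber n} (hz : z ∈ c.vdualChart.target) :
    HasFDerivAt (h.localField c)
      (-(stdSharp n).comp (fderiv ℝ (fderiv ℝ (h.localHamiltonian c)) z)) z := by
  have h1 : h.localField c = fun z => ((1, 0), 0) - stdSharp n (fderiv ℝ (h.localHamiltonian c) z) :=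
    funext (h.localField_eq c)
  have h2 := (((h.contDiffOn_fderiv_localHamiltonian c).contDiffAt
    ((isOpen_vdualChart_target c).mem_nhds hz)).differentiableAt (by simp)).hasFDerivAt
  rw [h1]
  exact ((stdSharp n).hasFDerivAt.comp z h2).const_sub _

theorem fderiv_fderiv_localHamiltonian_symm {z : Fiber n} (hz : z ∈ c.vdualChart.target)
    (x y : Fiber n) : fderiv ℝ (fderiv ℝ (h.localHamiltonian c)) z x y =
      fderiv ℝ (fderiv ℝ (h.localHamiltonian c)) z y x :=
  ((h.contDiffOn_localHamiltonian c).contDiffAt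
    ((isOpen_vdualChart_target c).mem_nhds hz)).isSymmSndFDerivAt
      (by simp; exact WithTop.coe_le_coe.2 le_top) x y

/-- The tangent space of `S_h` is the graph of the differential of the Hamiltonian vector field. -/
theorem mem_tangentTo_lagr {v : TangentBundle 𝓘(ℝ, Fiber n) (VDual n π)} (hv : v ∈ h.lagr)
    (w : Fiber n × Fiber n) :
    w ∈ tangentTo 𝓘(ℝ, Fiber n).tangent h.lagr v ↔
      w.2 = -stdSharp n (fderiv ℝ (fderiv ℝ (h.localHamiltonian (chartAround π v.proj.base)))
        ((chartAround π v.proj.base : AdaptedChart n π).vdualChart v.proj) w.1) := by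
  set c : AdaptedChart n π := chartAround π v.proj.base with hc
  have hvs : v.proj.base ∈ c.e.source := mem_chartAround _
  have key : ∀ y : TangentBundle 𝓘(ℝ, Fiber n) (VDual n π),
      y ∈ (chartAt (ModelProd (Fiber n) (Fiber n)) v).source →
      ((tangentCoord v y).2 = h.localField c (tangentCoord v y).1 ↔ y ∈ h.lagr) := by
    intro y hy
    have hy' := mem_chartAt_tangent_source.1 hy
    rw [tangentCoord_vdual v y hy', h.mem_lagr_iff c hy']
  have hv1 : (tangentCoord v v).1 = c.vdualChart v.proj := rfl
  set D : Fiber n →L[ℝ] Fiber n := -(stdSharp n).comp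
    (fderiv ℝ (fderiv ℝ (h.localHamiltonian c)) (c.vdualChart v.proj)) with hD
  have hX : HasFDerivAt (h.localField c) D (tangentCoord v v).1 :=
    h.hasFDerivAt_localField c (c.vdualChart.map_source hvs)
  constructor
  -- In the chart, `S_h` is the zero set of `ẋ - X(x)`.
  · intro hw
    have hφ : HasFDerivAt (fun x : Fiber n × Fiber n => x.2 - h.localField c x.1) _
        (tangentCoord v v) :=
      (hasFDerivAt_snd (𝕜 := ℝ) (p := tangentCoord v v)).sub
        (HasFDerivAt.comp (tangentCoord v v) hX hasFDerivAt_fst)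
    have h1 := fderiv_eq_zero_of_mem_tangentTo hφ
      (fun y hy hys => sub_eq_zero.2 ((key y hys).2 hy)) hw
    exact sub_eq_zero.1 h1
  -- The curve `s ↦ X(x + s w₁)` in `S_h` has velocity `w`.
  · intro hw
    have hline : HasDerivAt (fun s : ℝ => (tangentCoord v v).1 + s • w.1) w.1 0 := by
      simpa using ((hasDerivAt_id (0 : ℝ)).smul_const w.1).const_add (tangentCoord v v).1
    have h0 : (tangentCoord v v).1 + (0 : ℝ) • w.1 = (tangentCoord v v).1 := by simp
    have hX₀ : HasFDerivAt (h.localField c) D ((tangentCoord v v).1 + (0 : ℝ) • w.1) := by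
      rw [h0]; exact hX
    have hX' := HasFDerivAt.comp_hasDerivAt (f := fun s : ℝ => (tangentCoord v v).1 + s • w.1)
      (0 : ℝ) hX₀ hline
    refine mem_tangentTo_of_chart (g := fun s => ((tangentCoord v v).1 + s • w.1,
      h.localField c ((tangentCoord v v).1 + s • w.1))) ?_ ?_ ?_
    · rw [h0]
      exact Prod.ext rfl ((key v (mem_chart_source _ v)).2 hv).symm
    · have h2 := hline.prodMk hX'
      have h3 : (w.1, D w.1) = w := Prod.ext rfl hw.symm
      rw [h3] at h2
      exact h2
    · refine Filter.Eventually.of_forall fun s y hy hys => (key y hy).1 ?_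
      rw [hys]

/-- The tangent spaces of `S_h` are Lagrangian, by the symmetry of the Hessian of `H`. -/
theorem isLagrangianSubspace_lagr {v : TangentBundle 𝓘(ℝ, Fiber n) (VDual n π)}
    (hv : v ∈ h.lagr) : IsLagrangianSubspace (poissonJet n π v)
      ((tangentTo 𝓘(ℝ, Fiber n).tangent h.lagr v).comap
        (tangentTo 𝓘(ℝ, Fiber n).tangent (jetSet n π) v).subtype) := by
  have hJ := h.lagr_subset_jetSet hv
  obtain ⟨r, hr, hS⟩ := exists_poissonJet_eq hJ
  exact isLagrangianSubspace_graph (T := jetTangent n π v) (mem_tangentTo_jetSet hJ) hr hS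
    (h.fderiv_fderiv_localHamiltonian_symm _
      ((chartAround π v.proj.base).vdualChart.map_source (mem_chartAround _)))
    (fun w => h.mem_tangentTo_lagr hv w.1)

theorem isOpen_domain : IsOpen c.domain := by
  obtain ⟨e, he, hec⟩ := c.exists_atlas_eq_vdualChart
  have h1 : c.domain = Bundle.TotalSpace.proj ⁻¹' e.source := by rw [hec]; rfl
  rw [h1]
  exact e.open_source.preimage (FiberBundle.continuous_proj (Fiber n)
    (TangentSpace 𝓘(ℝ, Fiber n) : VDual n π → Type))

theorem contMDiffOn_residual :
    ContMDiffOn 𝓘(ℝ, Fiber n).tangent 𝓘(ℝ, (Fin n → ℝ) × (Fin n → ℝ)) ∞ (h.residual c)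
      c.domain := by
  obtain ⟨e, he, hec⟩ := c.exists_atlas_eq_vdualChart
  have hee : (e : VDual n π → Fiber n) = c.vdualChart := congrArg PartialEquiv.toFun hec
  have h1 : c.domain = Bundle.TotalSpace.proj ⁻¹' e.source := by rw [hec]; rfl
  have h2 : ContMDiffOn 𝓘(ℝ, Fiber n) 𝓘(ℝ, Fiber n) ∞ e e.source :=
    contMDiffOn_of_mem_maximalAtlas (IsManifold.subset_maximalAtlas he)
  have h3 : ContMDiffOn 𝓘(ℝ, Fiber n).tangent 𝓘(ℝ, Fiber n) ∞
      (fun v : TangentBundle 𝓘(ℝ, Fiber n) (VDual n π) => c.vdualChart v.proj) c.domain := by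
    rw [h1, ← hee]
    exact h2.comp (Bundle.contMDiff_proj (TangentSpace 𝓘(ℝ, Fiber n))).contMDiffOn
      (fun v hv => hv)
  have h4 : ContMDiffOn 𝓘(ℝ, Fiber n).tangent 𝓘(ℝ, Fiber n) ∞
      (fun v : TangentBundle 𝓘(ℝ, Fiber n) (VDual n π) => c.dvdual v.proj v.2) c.domain := by
    have h5 := (contMDiff_snd_tangentBundle_modelSpace (n := ∞) (Fiber n)
      𝓘(ℝ, Fiber n)).comp_contMDiffOn (h2.contMDiffOn_tangentMapWithin (m := ∞) (by simp)
        e.open_source.uniqueMDiffOn)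
    rw [h1]
    refine h5.congr fun v hv => ?_
    have h6 := mfderivWithin_of_isOpen (I := 𝓘(ℝ, Fiber n)) (I' := 𝓘(ℝ, Fiber n)) (f := e)
      e.open_source hv
    unfold AdaptedChart.dvdual
    rw [← hee, ← h6]
    rfl
  have hX : ContMDiffOn 𝓘(ℝ, Fiber n) 𝓘(ℝ, Fiber n) ∞ (h.localField c) c.vdualChart.target :=
    (h.contDiffOn_localField c).contMDiffOn
  have h7 := h4.sub (hX.comp h3 fun v hv => c.vdualChart.map_source hv)
  let P : Fiber n →L[ℝ] (Fin n → ℝ) × (Fin n → ℝ) :=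
    ((ContinuousLinearMap.snd ℝ ℝ (Fin n → ℝ)).comp
      (ContinuousLinearMap.fst ℝ (Base n) (Fin n → ℝ))).prod
      (ContinuousLinearMap.snd ℝ (Base n) (Fin n → ℝ))
  refine (P.contMDiff.comp_contMDiffOn h7).congr fun v hv => ?_
  exact Prod.ext rfl (funext fun i => (sub_neg_eq_add _ _).symm)

/-- The functions `q̇ⁱ - ∂H/∂p_i`, `ṗ_i + ∂H/∂qⁱ` are independent on `J¹π₁*`: along the vertical
lines `s ↦ v + s u` of `J¹π₁*` they are affine, with derivative the coordinates of `u`. -/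
theorem exists_mfderiv_residual_eq {v : TangentBundle 𝓘(ℝ, Fiber n) (VDual n π)}
    (hv : v ∈ jetSet n π) (hc : v ∈ c.domain) (g : (Fin n → ℝ) × (Fin n → ℝ)) :
    ∃ w ∈ tangentTo 𝓘(ℝ, Fiber n).tangent (jetSet n π) v,
      mfderiv 𝓘(ℝ, Fiber n).tangent 𝓘(ℝ, (Fin n → ℝ) × (Fin n → ℝ)) (h.residual c) v w = g := by
  obtain ⟨ξ, X⟩ := v
  have hξ : ξ.base ∈ c.e.source := hc
  obtain ⟨u, hu⟩ := (c.dvdual_bijective hξ).surjective ((0, g.1), g.2)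
  let γ : ℝ → TangentBundle 𝓘(ℝ, Fiber n) (VDual n π) := fun s => ⟨ξ, X + s • u⟩
  have hγ0 : γ 0 = ⟨ξ, X⟩ := congrArg (Bundle.TotalSpace.mk ξ) (by rw [zero_smul, add_zero])
  have hd : HasDerivAt (fun s : ℝ => (((chartAt (Fiber n) ξ ξ, X + s • u)) : Fiber n × Fiber n))
      ((0, u) : Fiber n × Fiber n) 0 := by
    have h1 := ((hasDerivAt_id (0 : ℝ)).smul_const (id u : Fiber n)).const_add (id X : Fiber n)
    have h2 := (hasDerivAt_const (0 : ℝ) (chartAt (Fiber n) ξ ξ : Fiber n)).prodMk h1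
    rw [one_smul] at h2
    exact h2
  obtain ⟨hγd, hγv⟩ := mfderiv_eq_of_tangentCoord_eq (γ := γ) (w := (0, u))
    (Filter.Eventually.of_forall fun s => mem_chartAt_tangent_source.2 (mem_chartAround _))
    (Filter.Eventually.of_forall fun s => tangentCoord_mk_self (γ 0) _) hd
  have hres : MDifferentiableAt 𝓘(ℝ, Fiber n).tangent 𝓘(ℝ, (Fin n → ℝ) × (Fin n → ℝ))
      (h.residual c) (γ 0) := by
    rw [hγ0]
    exact ((h.contMDiffOn_residual c).contMDiffAt
      ((isOpen_domain c).mem_nhds hc)).mdifferentiableAt (by simp)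
  have h3 := hasDerivAt_comp_of_mdifferentiableAt hres hγd
  rw [hγv] at h3
  have h4 : ∀ s, h.residual c (γ s) = h.residual c (γ 0) + s • g := by
    intro s
    have h5 : ∀ s : ℝ, (c.dvdual ξ (X + s • u) : Fiber n) = c.dvdual ξ X + s • ((0, g.1), g.2) := by
      intro s
      rw [map_add, map_smul, hu]
    have h6 : ∀ s : ℝ, h.residual c (γ s) =
      (fun i => (c.dvdual ξ (X + s • u)).1.2 i - h.partialP c i (c.vdualChart ξ),
        fun i => (c.dvdual ξ (X + s • u)).2 i + h.partialQ c i (c.vdualChart ξ)) := fun s => rfl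
    rw [h6, h6, h5, h5]
    refine Prod.ext (funext fun i => ?_) (funext fun i => ?_)
    · simp; ring
    · simp; ring
  have h7 : HasDerivAt (fun s => h.residual c (γ s)) g 0 := by
    have h8 := ((hasDerivAt_id (0 : ℝ)).smul_const g).const_add (h.residual c (γ 0))
    rw [one_smul] at h8
    exact h8.congr_of_eventuallyEq (Filter.Eventually.of_forall h4)
  refine ⟨((0, u) : Fiber n × Fiber n), ?_, ?_⟩
  · refine (mem_tangentTo_jetSet hv _).2 ?_
    have h9 : ∀ Y : Fiber n, dtime ξ Y = Y.1.1 := dtime_apply ξ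
    refine (h9 u).symm.trans ((fst_dvdual c hξ u).symm.trans ?_)
    rw [hu]
  · have h10 := h3.unique h7
    rw [hγ0] at h10
    exact h10

theorem isDefinedBy_residual :
    IsDefinedBy 𝓘(ℝ, Fiber n).tangent (jetSet n π) h.lagr c.domain (h.residual c) where
  isOpen := isOpen_domain c
  contMDiffOn := h.contMDiffOn_residual c
  submersive v hv g := h.exists_mfderiv_residual_eq c hv.1 hv.2 g
  eq_zeros := by
    ext v
    constructor
    · rintro ⟨hv, hc⟩
      have hJ := h.lagr_subset_jetSet hv
      exact ⟨⟨hJ, hc⟩, (h.residual_eq_zero_iff c hc hJ).2 hv⟩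
    · rintro ⟨⟨hJ, hc⟩, hv⟩
      exact ⟨(h.residual_eq_zero_iff c hc hJ).1 hv, hc⟩

end HamiltonianSection

/-- Defining equations may be transported by a linear isomorphism of their target. -/
theorem IsDefinedBy.comp_equiv {F H : Type*} [NormedAddCommGroup F] [NormedSpace ℝ F]
    [TopologicalSpace H] {I : ModelWithCorners ℝ F H} {X : Type*} [TopologicalSpace X]
    [ChartedSpace H X] {G G' : Type*} [NormedAddCommGroup G] [NormedSpace ℝ G]
    [NormedAddCommGroup G'] [NormedSpace ℝ G'] {J C U : Set X} {f : X → G}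
    (hf : IsDefinedBy I J C U f) (κ : G ≃L[ℝ] G') : IsDefinedBy I J C U (fun x => κ (f x)) where
  isOpen := hf.isOpen
  contMDiffOn := (κ : G →L[ℝ] G').contMDiff.comp_contMDiffOn hf.contMDiffOn
  submersive x hx g := by
    obtain ⟨w, hw, hwg⟩ := hf.submersive x hx (κ.symm g)
    refine ⟨w, hw, ?_⟩
    have h1 : MDifferentiableAt I 𝓘(ℝ, G) f x :=
      (hf.contMDiffOn.contMDiffAt (hf.isOpen.mem_nhds hx.2)).mdifferentiableAt (by simp)
    have h2 := ((κ : G →L[ℝ] G').hasMFDerivAt.comp x h1.hasMFDerivAt).mfderiv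
    refine (DFunLike.congr_fun h2 w).trans ((congrArg κ hwg).trans (κ.apply_symm_apply g))
  eq_zeros := by
    rw [hf.eq_zeros]
    ext x
    simp

theorem HamiltonianSection.isLagrangianInJet_lagr (h : HamiltonianSection n π) :
    IsLagrangianInJet h.lagr := by
  let κ : ((Fin n → ℝ) × (Fin n → ℝ)) ≃L[ℝ] (Fin (n + n) → ℝ) :=
    ContinuousLinearEquiv.ofFinrankEq (by simp)
  exact ⟨⟨h.lagr_subset_jetSet, n + n, fun v _ => ⟨(chartAround π v.proj.base).domain, _,
    mem_chartAround _, (h.isDefinedBy_residual (chartAround π v.proj.base)).comp_equiv κ⟩⟩,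
    fun v hv => h.isLagrangianSubspace_lagr hv⟩

end Lagrangian

end TimeDep

end

open TimeDep

theorem mainTheorem8 (n : ℕ) {M : Type*} [TopologicalSpace M] [ChartedSpace (Base n) M]
    [IsManifold 𝓘(ℝ, Base n) ∞ M] (π : M → ℝ) [IsFibration n π]
    (h : HamiltonianSection n π) :
    (∀ (U : Set ℝ) (τ : ℝ → VDual n π), IsOpen U →
      ContMDiffOn 𝓘(ℝ, ℝ) 𝓘(ℝ, Base n × (Fin n → ℝ)) ∞ τ U →
      (∀ t ∈ U, time (τ t) = t) →
      (h.IsSolution τ U ↔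
        ∀ t ∈ U, ((bPi n π).symm (h.dhTilde (τ t))).1 = jetProlong τ t)) ∧
    IsLagrangianInJet h.lagr ∧
    ∀ c : AdaptedChart n π,
      IsDefinedBy 𝓘(ℝ, Base n × (Fin n → ℝ)).tangent (jetSet n π) h.lagr
        c.domain (h.residual c) :=
  ⟨fun _ _ hU hτ ht => h.isSolution_iff hU hτ ht, h.isLagrangianInJet_lagr,
    h.isDefinedBy_residual⟩
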